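/- Let $p$ be a prime and let $(R,\mathfrak m,k)$ be a Noetherian local ring of characteristic $p$ and Krull dimension $d$. For $e\ge 0$ let $F^e_*R$ denote $R$ as an $R$-module by restriction of scalars along the $e$-th iterate of Frobenius, so that $r\cdot F^e_*x=F^e_*(r^{p^e}x)$. Assume that $R$ is $F$-finite, i.e. $F_*R$ is a finitely generated $R$-module, and put $\alpha(R)=\log_p[k:k^p]$. A Cartier subalgebra on $R$ is a graded subring $\mathcal D=\bigoplus_{e\ge0}\mathcal D_e$ of $\bigoplus_{e\ge 0}\operatorname{Hom}_R(F^e_*R,R)$, with multiplication $\phi_1\cdot\phi_2=\phi_1\circ F^{e_1}_*\phi_2$ for $\phi_i$ of degree $e_i$, such that $\mathcal D_0=\operatorname{Hom}_R(R,R)=R$ and $\mathcal D_e\neq0$ for some $e>0$. Let $a_e^{\mathcal D}$ be the maximal number of $\mathcal D$-summands in a direct sum decomposition $F^e_*R\simeq\bigoplus_i M_i$ of $R$-modules, where $M_j$ is a $\mathcal D$-summand if $M_j\simeq R$ and the projection $F^e_*R\to M_j\simeq R$ belongs to $\mathcal D_e$. Put $\Gamma_{\mathcal D}=\{e : a_e^{\mathcal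 D}\ne0\}$. The $F$-signature of $(R,\mathcal D)$ is $$s(R,\mathcal D)=\lim_{e\in\Gamma_{\mathcal D},\ e\to\infty}\frac{a_e^{\mathcal D}}{p^{e(d+\alpha(R))}},$$ with $s(R,\mathcal D)=0$ by convention if $\Gamma_{\mathcal D}$ is finite, i.e. contains no $e>0$. Let $\mathcal E\subseteq\mathcal D$ be Cartier subalgebras on $R$, and suppose that there is $c\in R$, not in any minimal prime of $R$, such that $\mathcal D_e\cdot F^e_*c\subseteq\mathcal E_e$ for all $e>0$, i.e. the map $F^e_*x\mapsto\phi(F^e_*(cx))$ belongs to $\mathcal E_e$ for every $\phi\in\mathcal D_e$. Then $s(R,\mathcal D)$ and $s(R,\mathcal E)$ exist and $$s(R,\mathcal D)=s(R,\mathcal E).$$ -/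

import Mathlib

open Filter Topology

universe u

namespace FSig

section Pushforward

/-- `F^e_* R`: a copy of the additive group of `R`, on which `r : R` acts as multiplication
by `r ^ p ^ e`. -/
def FrobPush (R : Type u) (_p _e : ℕ) : Type u := R

variable (R : Type u) [CommRing R] (p e : ℕ)

instance : AddCommGroup (FrobPush R p e) := inferInstanceAs (AddCommGroup R)

/-- The additive bijection `x ↦ F^e_* x`. -/
def push : R ≃+ FrobPush R p e := AddEquiv.refl R

variable [Fact p.Prime] [CharP R p]

/-- The `R`-module structure of `F^e_* R`, by restriction of scalars along the `e`-th iterate of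
the Frobenius endomorphism. -/
noncomputable instance : Module R (FrobPush R p e) :=
  Module.compHom R (iterateFrobenius R p e)

variable {R p e}

theorem smul_push (r x : R) : r • push R p e x = push R p e (r ^ p ^ e * x) := rfl

variable (R p)

/-- `R` is `F`-finite: `F_* R` is a finitely generated `R`-module. -/
def IsFFinite : Prop := Module.Finite R (FrobPush R p 1)

end Pushforward

section CartierMaps

variable (R : Type u) [CommRing R] (p : ℕ) [Fact p.Prime] [CharP R p]

/-- The `p^{-e}`-linear maps on `R`, i.e. the degree `e` part `Hom_R(F^e_* R, R)` of the total
Cartier algebra of `R`. -/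
abbrev CartierMap (e : ℕ) : Type u := FrobPush R p e →ₗ[R] R

variable {R p}

/-- The product in the total Cartier algebra: `φ · ψ = φ ∘ F^a_* ψ`, that is
`F^{a+b}_* x ↦ φ (F^a_* (ψ (F^b_* x)))`. -/
noncomputable def CartierMap.mul {a b : ℕ} (φ : CartierMap R p a) (ψ : CartierMap R p b) :
    CartierMap R p (a + b) where
  toFun x := φ (push R p a (ψ (push R p b ((push R p (a + b)).symm x))))
  map_add' x y := by simp only [map_add]
  map_smul' r x := by
    obtain ⟨x, rfl⟩ := (push R p (a + b)).surjective x
    rw [smul_push, AddEquiv.symm_apply_apply, AddEquiv.symm_apply_apply, pow_add, pow_mul,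
      ← smul_push, map_smul, smul_eq_mul, ← smul_push, map_smul, RingHom.id_apply]

/-- `φ · F^e_* c`, the map `F^e_* x ↦ φ (F^e_* (c x))`. -/
noncomputable def CartierMap.mulPush {e : ℕ} (φ : CartierMap R p e) (c : R) :
    CartierMap R p e where
  toFun x := φ (push R p e (c * (push R p e).symm x))
  map_add' x y := by simp only [map_add, mul_add]
  map_smul' r x := by
    obtain ⟨x, rfl⟩ := (push R p e).surjective x
    rw [smul_push, AddEquiv.symm_apply_apply, AddEquiv.symm_apply_apply, mul_left_comm,
      ← smul_push, map_smul, RingHom.id_apply]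

variable (R p)

/-- A Cartier subalgebra on `R`, given by its homogeneous parts: a graded subring
`⨁ D_e` of the total Cartier algebra `⨁ Hom_R(F^e_* R, R)` (the field `zero_eq_top` gives the unit;
closure under `𝔽_p`-scalars is automatic for additive subgroups) with `D_0 = Hom_R(R, R)` and
`D_e ≠ 0` for some `e > 0`. -/
structure CartierSubalgebra where
  /-- The degree `e` part. -/
  part : (e : ℕ) → AddSubgroup (CartierMap R p e)
  zero_eq_top : part 0 = ⊤
  mul_mem : ∀ {a b : ℕ} {φ : CartierMap R p a} {ψ : CartierMap R p b},
    φ ∈ part a → ψ ∈ part b → φ.mul ψ ∈ part (a + b)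
  exists_ne_bot : ∃ e, 0 < e ∧ part e ≠ ⊥

/-- Inclusion of Cartier subalgebras, degree by degree. -/
instance : LE (CartierSubalgebra R p) := ⟨fun E D => ∀ e, E.part e ≤ D.part e⟩

end CartierMaps

section SplittingNumbers

/-- The projection onto the `j`-th summand of an internal direct sum decomposition. -/
noncomputable def summandProj {R : Type u} [CommRing R] {N : Type u} [AddCommGroup N] [Module R N]
    {n : ℕ} (M : Fin n → Submodule R N) (hM : DirectSum.IsInternal M) (j : Fin n) :
    N →ₗ[R] M j :=
  DirectSum.component R (Fin n) (fun i => M i) j ∘ₗ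
    (LinearEquiv.ofBijective (DirectSum.coeLinearMap M) hM).symm.toLinearMap

variable {R : Type u} [CommRing R] {p : ℕ} [Fact p.Prime] [CharP R p]

/-- In the decomposition `F^e_* R = ⨁ M_i`, the summand `M_j` is a `D`-summand: `M_j ≃ R` and the
projection `F^e_* R → M_j ≃ R` belongs to `D_e`. -/
def IsDSummand (D : CartierSubalgebra R p) (e : ℕ) {n : ℕ}
    (M : Fin n → Submodule R (FrobPush R p e)) (hM : DirectSum.IsInternal M) (j : Fin n) : Prop :=
  ∃ f : M j ≃ₗ[R] R, f.toLinearMap ∘ₗ summandProj M hM j ∈ D.part e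

/-- The possible numbers of `D`-summands in the direct sum decompositions of `F^e_* R`. -/
def summandCounts (D : CartierSubalgebra R p) (e : ℕ) : Set ℕ :=
  {a | ∃ (n : ℕ) (M : Fin n → Submodule R (FrobPush R p e)) (hM : DirectSum.IsInternal M),
    a = Set.ncard {j | IsDSummand D e M hM j}}

/-- The `e`-th `F`-splitting number `a_e^D`: the maximal number of `D`-summands in a direct sum
decomposition of `F^e_* R` (see `isGreatest_splittingNumber`). -/
noncomputable def splittingNumber (D : CartierSubalgebra R p) (e : ℕ) : ℕ :=
  sSup (summandCounts D e)

theorem finite_frobPush (hF : IsFFinite R p) (e : ℕ) : Module.Finite R (FrobPush R p e) := by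
  have key : ∀ n, (iterateFrobenius R p n).Finite ↔ Module.Finite R (FrobPush R p n) :=
    fun _ => Iff.rfl
  rw [← key]
  have h1 : (iterateFrobenius R p 1).Finite := (key 1).2 hF
  induction e with
  | zero =>
    have : iterateFrobenius R p 0 = RingHom.id R := by
      ext x; simp
    rw [this]; exact RingHom.Finite.id R
  | succ n ih =>
    have : iterateFrobenius R p (n + 1) = (iterateFrobenius R p n).comp (iterateFrobenius R p 1) := by
      ext x; simp [iterateFrobenius_def, frobenius_def, pow_succ', pow_mul]
    rw [this]; exact ih.comp h1

theorem isGreatest_splittingNumber [Nontrivial R] (hF : IsFFinite R p)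
    (D : CartierSubalgebra R p) (e : ℕ) :
    IsGreatest (summandCounts D e) (splittingNumber D e) := by
  have := finite_frobPush hF e
  obtain ⟨m, g, hg⟩ := Module.Finite.exists_fin' R (FrobPush R p e)
  have hbdd : BddAbove (summandCounts D e) := by
    refine ⟨m, ?_⟩
    rintro a ⟨n, M, hM, rfl⟩
    set S := {j | IsDSummand D e M hM j} with hS
    choose f hf using fun j : S => j.2
    let P : FrobPush R p e →ₗ[R] (S → R) :=
      LinearMap.pi fun j => (f j).toLinearMap ∘ₗ summandProj M hM j
    have hP : Function.Surjective P := by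
      intro v
      let w : DirectSum (Fin n) fun i => M i :=
        DFinsupp.equivFunOnFintype.symm
          fun i => open Classical in if h : i ∈ S then (f ⟨i, h⟩).symm (v ⟨i, h⟩) else 0
      refine ⟨LinearEquiv.ofBijective (DirectSum.coeLinearMap M) hM w, ?_⟩
      funext j
      have : summandProj M hM j (LinearEquiv.ofBijective (DirectSum.coeLinearMap M) hM w) =
          (f j).symm (v j) := by
        simp only [summandProj, LinearMap.comp_apply, LinearEquiv.coe_coe,
          LinearEquiv.symm_apply_apply]
        change DFinsupp.equivFunOnFintype w j = _
        simp only [w, Equiv.apply_symm_apply]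
        rw [dif_pos j.2]
      simp [P, this]
    have : Fintype S := Fintype.ofFinite S
    have := card_le_of_surjective R (P ∘ₗ g) (hP.comp hg)
    rw [Fintype.card_fin, ← Nat.card_eq_fintype_card] at this
    exact this
  refine ⟨Nat.sSup_mem ?_ hbdd, fun a ha => le_csSup hbdd ha⟩
  exact ⟨_, 1, fun _ => ⊤, DirectSum.isInternal_submodule_of_iSupIndep_of_iSup_eq_top
    (iSupIndep_subsingleton _) (by simp), rfl⟩

/-- The semigroup `Γ_D` of all `e` with `a_e^D ≠ 0`. -/
def semigroup (D : CartierSubalgebra R p) : Set ℕ := {e | splittingNumber D e ≠ 0}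

end SplittingNumbers

section Signature

variable (R : Type u) [CommRing R] [IsLocalRing R] (p : ℕ) [Fact p.Prime] [CharP R p]

theorem charP_residueField : CharP (IsLocalRing.ResidueField R) p := by
  have h : (p : IsLocalRing.ResidueField R) = 0 := by
    rw [← map_natCast (IsLocalRing.residue R) p, CharP.cast_eq_zero, map_zero]
  obtain ⟨q, hq⟩ := CharP.exists (IsLocalRing.ResidueField R)
  have hd : q ∣ p := (CharP.cast_eq_zero_iff (IsLocalRing.ResidueField R) q p).1 h
  rcases (Nat.dvd_prime (Fact.out : p.Prime)).1 hd with h1 | h1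
  · exact absurd h1 (CharP.char_ne_one (IsLocalRing.ResidueField R) q)
  · exact h1 ▸ hq

/-- `α(R) = log_p [k : k^p]`, where `k` is the residue field of `R`. -/
noncomputable def alpha : ℝ :=
  haveI := charP_residueField R p
  Real.logb p (Module.finrank (frobenius (IsLocalRing.ResidueField R) p).fieldRange
    (IsLocalRing.ResidueField R))

variable {R p}

/-- `s` is the `F`-signature of `(R, D)`: the limit of `a_e^D / p^{e (d + α(R))}` as `e → ∞` in
`Γ_D`, where `d = dim R`. If `Γ_D` has no arbitrarily large elements (that is, when no map in any
`D_e` with `e > 0` is surjective), the `F`-signature is `0` by convention. -/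
def HasFSignature (D : CartierSubalgebra R p) (s : ℝ) : Prop :=
  ∃ d : ℕ, ringKrullDim R = d ∧
    ((semigroup D).Infinite →
      Tendsto (fun e : ℕ => (splittingNumber D e : ℝ) / (p : ℝ) ^ ((e : ℝ) * (d + alpha R p)))
        (atTop ⊓ 𝓟 (semigroup D)) (𝓝 s)) ∧
    ((semigroup D).Finite → s = 0)

theorem HasFSignature.unique {D : CartierSubalgebra R p} {s t : ℝ} (hs : HasFSignature D s)
    (ht : HasFSignature D t) : s = t := by
  obtain ⟨d, hd, h1, h2⟩ := hs
  obtain ⟨d', hd', h1', h2'⟩ := ht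
  obtain rfl : d = d' := by rw [hd] at hd'; exact_mod_cast hd'
  rcases (semigroup D).finite_or_infinite with h | h
  · rw [h2 h, h2' h]
  · haveI : (atTop ⊓ 𝓟 (semigroup D)).NeBot :=
      frequently_mem_iff_neBot.1 (Nat.frequently_atTop_iff_infinite.2 h)
    exact tendsto_nhds_unique (h1 h) (h1' h)

end Signature

end FSig

/-!
Let `I_e^D` be the ideal of all `x` such that every map in `D_e` sends `F^e_* x` into the maximal
ideal. Then `a_e^D` is the minimal number of generators of `F^e_* R / F^e_* I_e^D`, and everything
reduces to counting generators of modules of the form `F^e_* (R / I)`. Put `ν = p^d [k : k^p]`, so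
that `p^{e (d + α(R))} = ν^e`. If `c` is a nonzerodivisor, then `dim R/c < d`, so that `F^e_* (R/c)`
has only `O(ν^e / p^e)` generators.

Comparison: `D_e · F^e_* c ⊆ E_e` gives `c I_e^E ⊆ I_e^D`, so `a_e^D - a_e^E` is between `0` and the
number of generators of `F^e_* (R/c)`, which is negligible.

Existence: an infinite `Γ_D` forces `R` to be reduced. All zerodivisors lie in every `I_e^D`; hence
if `R` is not a domain, the sum of two distinct minimal primes provides a nonzerodivisor in every
`I_e^D`, and the limit is `0`. If `R` is a domain, then `a_e^D` is at most the rank of `F^e_* R`,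
which is the `e`-th power of the rank of `F_* R`, and the latter is at most `ν`. The limit is again
`0` if the inequality is strict. In case of equality, for `n` in `Γ_D` there are `ν^n` maps in `D_n`
that form a map `F^{e+n}_* R → (F^e_* R)^{ν^n}` whose image contains `F^e_* c` times the target, for
some `c ≠ 0` independent of `e`. Hence `ν^n a_e^D ≤ a_{e+n}^D + O(ν^e / p^e)`, so that
`a_e^D / ν^e` is increasing along `Γ_D` up to a geometric error.
-/

namespace FSig

section GeneratedModulo

variable {R M N : Type*} [CommRing R] [AddCommGroup M] [Module R M] [AddCommGroup N] [Module R N]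

/-- `J` is generated by `g` elements modulo `K`: it lies in the span of `K` and `g` elements of
the ambient module. The elements need not belong to `J`, and fewer than `g` may be used, so that the
notion is monotone in all of its arguments. -/
def GeneratedModulo (K J : Submodule R M) (g : ℕ) : Prop :=
  ∃ s : Finset M, s.card ≤ g ∧ J ≤ K ⊔ Submodule.span R (s : Set M)

namespace GeneratedModulo

variable {I J K : Submodule R M} {g h : ℕ}

theorem of_le (hJ : J ≤ K) : GeneratedModulo K J 0 :=
  ⟨∅, le_rfl, le_sup_of_le_left hJ⟩

theorem mono (hJ : GeneratedModulo K J g) {K' J' : Submodule R M} {g' : ℕ} (hK' : K ≤ K')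
    (hJ' : J' ≤ J) (hg : g ≤ g') : GeneratedModulo K' J' g' := by
  obtain ⟨s, hs, hJs⟩ := hJ
  exact ⟨s, hs.trans hg, hJ'.trans (hJs.trans (sup_le_sup_right hK' _))⟩

theorem trans (hI : GeneratedModulo J I g) (hJ : GeneratedModulo K J h) :
    GeneratedModulo K I (g + h) := by
  classical
  obtain ⟨s, hs, hIs⟩ := hI
  obtain ⟨t, ht, hJt⟩ := hJ
  refine ⟨t ∪ s, (Finset.card_union_le t s).trans (by omega), ?_⟩
  rw [Finset.coe_union, Submodule.span_union, ← sup_assoc]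
  exact hIs.trans (sup_le_sup_right hJt _)

theorem sup_left (hJ : GeneratedModulo K J g) : GeneratedModulo K (K ⊔ J) g := by
  obtain ⟨s, hs, hJs⟩ := hJ
  exact ⟨s, hs, sup_le le_sup_left hJs⟩

theorem map (hJ : GeneratedModulo K J g) (f : M →ₗ[R] N) {L : Submodule R N}
    (hK : K ≤ L.comap f) : GeneratedModulo L (J.map f) g := by
  classical
  obtain ⟨s, hs, hJs⟩ := hJ
  refine ⟨s.image f, Finset.card_image_le.trans hs, ?_⟩
  rw [Finset.coe_image, Submodule.span_image]
  refine (Submodule.map_mono hJs).trans ?_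
  rw [Submodule.map_sup]
  exact sup_le_sup_right (Submodule.map_le_iff_le_comap.2 hK) _

theorem biSup {ι : Type*} (s : Finset ι) {J : ι → Submodule R M}
    (hJ : ∀ i ∈ s, GeneratedModulo K (J i) g) : GeneratedModulo K (⨆ i ∈ s, J i) (s.card * g) := by
  classical
  induction s using Finset.induction_on with
  | empty => exact (of_le (by simp)).mono le_rfl le_rfl (Nat.zero_le _)
  | insert i s hi ih =>
    have hs := ih fun j hj => hJ j (Finset.mem_insert_of_mem hj)
    have hi' : GeneratedModulo (K ⊔ ⨆ j ∈ s, J j) (J i) g :=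
      (hJ i (Finset.mem_insert_self i s)).mono le_sup_left le_rfl le_rfl
    refine (hi'.sup_left.trans hs.sup_left).mono le_rfl ?_ ?_
    · rw [Finset.iSup_insert]
      exact sup_le le_sup_right (le_sup_right.trans le_sup_left)
    · rw [Finset.card_insert_of_notMem hi]
      lia

theorem ker {ι : Type*} [Fintype ι] {f : M →ₗ[R] ι → R} (hf : Function.Surjective f) :
    GeneratedModulo (LinearMap.ker f) ⊤ (Fintype.card ι) := by
  classical
  choose y hy using fun i => hf (Pi.single i 1)
  refine ⟨Finset.univ.image y, Finset.card_image_le, fun x _ => ?_⟩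
  have hx : x - ∑ i, f x i • y i ∈ LinearMap.ker f := by
    rw [LinearMap.mem_ker, map_sub, map_sum, sub_eq_zero]
    simp only [map_smul, hy, ← pi_eq_sum_univ']
  rw [← sub_add_cancel x (∑ i, f x i • y i)]
  exact Submodule.add_mem_sup hx <| sum_mem fun i _ => Submodule.smul_mem _ _ <|
    Submodule.subset_span (Finset.mem_image_of_mem y (Finset.mem_univ i))

theorem pi (hJ : GeneratedModulo K J g) (ι : Type*) [Fintype ι] :
    GeneratedModulo (Submodule.pi Set.univ fun _ : ι => K) (Submodule.pi Set.univ fun _ : ι => J)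
      (Fintype.card ι * g) := by
  classical
  have hK (i : ι) : K ≤ (Submodule.pi Set.univ fun _ => K).comap
      (LinearMap.single R (fun _ : ι => M) i) := by
    intro x hx j _
    obtain rfl | hij := eq_or_ne j i
    · rwa [LinearMap.single_apply, Pi.single_eq_same]
    · rw [LinearMap.single_apply, Pi.single_eq_of_ne hij]
      exact K.zero_mem
  refine (biSup Finset.univ fun i _ => hJ.map _ (hK i)).mono le_rfl ?_ le_rfl
  rw [← Submodule.iSup_map_single]
  exact iSup_mono fun i => le_iSup_of_le (Finset.mem_univ i) le_rfl

theorem finrank_le [StrongRankCondition R] (hM : GeneratedModulo (⊥ : Submodule R M) ⊤ g) :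
    Module.finrank R M ≤ g := by
  obtain ⟨s, hs, htop⟩ := hM
  rw [bot_sup_eq] at htop
  calc Module.finrank R M = Module.finrank R (Submodule.span R (s : Set M)) := by
        rw [top_le_iff.1 htop, finrank_top]
    _ ≤ s.card := finrank_span_finset_le_card s
    _ ≤ g := hs

open IsLocalRing in
theorem nakayama [IsLocalRing R] [Module.Finite R M]
    (hM : GeneratedModulo (K ⊔ maximalIdeal R • ⊤) ⊤ g) : GeneratedModulo K ⊤ g := by
  obtain ⟨s, hs, htop⟩ := hM
  refine ⟨s, hs, Submodule.le_of_le_smul_of_le_jacobson_bot Module.Finite.fg_top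
    (maximalIdeal_le_jacobson ⊥) ?_⟩
  rwa [sup_right_comm]

open IsLocalRing in
theorem card_le_of_surjective [IsLocalRing R] (hM : GeneratedModulo K ⊤ g) {ι : Type*} [Fintype ι]
    (f : M →ₗ[R] ι → R) (hf : Function.Surjective f)
    (hK : ∀ x ∈ K, ∀ i, f x i ∈ maximalIdeal R) : Fintype.card ι ≤ g := by
  classical
  have hpi : GeneratedModulo (maximalIdeal R • ⊤ : Submodule R (ι → R)) ⊤ g := by
    rw [← LinearMap.range_eq_top.2 hf, ← Submodule.map_top]
    refine hM.map f fun x hx => ?_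
    rw [Submodule.map_top, LinearMap.range_eq_top.2 hf, Submodule.mem_comap,
      pi_eq_sum_univ' (f x)]
    exact sum_mem fun i _ => Submodule.smul_mem_smul (hK x hx i) trivial
  have := (hpi.mono le_sup_right le_rfl le_rfl : GeneratedModulo (⊥ ⊔ _) ⊤ g).nakayama.finrank_le
  rwa [Module.finrank_fintype_fun_eq_card] at this

end GeneratedModulo

end GeneratedModulo

section PushIdeal

variable {R : Type u} [CommRing R] {p : ℕ} [Fact p.Prime] [CharP R p]

/-- The endomorphism `F^e_* x ↦ F^e_* (c x)` of `F^e_* R`. -/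
noncomputable def pushMul (p e : ℕ) [Fact p.Prime] [CharP R p] (c : R) :
    FrobPush R p e →ₗ[R] FrobPush R p e where
  toFun x := push R p e (c * (push R p e).symm x)
  map_add' x y := by simp only [map_add, mul_add]
  map_smul' r x := by
    obtain ⟨x, rfl⟩ := (push R p e).surjective x
    simp only [smul_push, AddEquiv.symm_apply_apply, RingHom.id_apply, mul_left_comm]

theorem pushMul_push (e : ℕ) (c x : R) : pushMul p e c (push R p e x) = push R p e (c * x) := rfl

/-- The pushforward `F^a_* x ↦ F^{a+b}_* (x ^ p ^ b)` along `F^a` of the `b`-th iterate of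
Frobenius, seen as an `R`-linear map `R → F^b_* R`. -/
noncomputable def pushFrobenius (R : Type u) [CommRing R] (p a b : ℕ) [Fact p.Prime] [CharP R p] :
    FrobPush R p a →ₗ[R] FrobPush R p (a + b) where
  toFun x := push R p (a + b) ((push R p a).symm x ^ p ^ b)
  map_add' x y := by simp only [map_add, add_pow_char_pow]
  map_smul' r x := by
    obtain ⟨x, rfl⟩ := (push R p a).surjective x
    simp only [smul_push, AddEquiv.symm_apply_apply, RingHom.id_apply, mul_pow, pow_add, pow_mul]

/-- The submodule `F^e_* I` of `F^e_* R`. -/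
def pushIdeal (p e : ℕ) [Fact p.Prime] [CharP R p] (I : Ideal R) :
    Submodule R (FrobPush R p e) where
  carrier := {x | (push R p e).symm x ∈ I}
  add_mem' hx hy := I.add_mem hx hy
  zero_mem' := I.zero_mem
  smul_mem' r _ hx := I.mul_mem_left (r ^ p ^ e) hx

variable {e : ℕ} {I J K : Ideal R}

theorem push_mem_pushIdeal {x : R} : push R p e x ∈ pushIdeal p e I ↔ x ∈ I := Iff.rfl

theorem pushIdeal_mono (h : I ≤ J) : pushIdeal p e I ≤ pushIdeal p e J := fun _ hx => h hx

theorem pushIdeal_top : pushIdeal p e (⊤ : Ideal R) = ⊤ := rfl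

theorem pushIdeal_sup_le : pushIdeal p e (I ⊔ J) ≤ pushIdeal p e I ⊔ pushIdeal p e J := by
  intro z hz
  obtain ⟨z, rfl⟩ := (push R p e).surjective z
  obtain ⟨x, hx, y, hy, rfl⟩ := Submodule.mem_sup.1 (push_mem_pushIdeal.1 hz)
  exact Submodule.mem_sup.2 ⟨push R p e x, hx, push R p e y, hy, rfl⟩

theorem pushIdeal_span_le_biSup (s : Set R) :
    pushIdeal p e (Ideal.span s) ≤ ⨆ y ∈ s, LinearMap.range (pushMul p e y) := by
  intro z hz
  obtain ⟨z, rfl⟩ := (push R p e).surjective z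
  obtain ⟨c, hcs, rfl⟩ := Submodule.mem_span_set.1 (push_mem_pushIdeal.1 hz)
  rw [Finsupp.sum, map_sum]
  refine sum_mem fun y hy => Submodule.mem_iSup_of_mem y (Submodule.mem_iSup_of_mem (hcs hy) ?_)
  exact ⟨push R p e (c y), by rw [pushMul_push, smul_eq_mul, mul_comm]⟩

theorem pushIdeal_span_pow_le {s : Set R} (hs : s ⊆ I) :
    pushIdeal p e (Ideal.span ((· ^ p ^ e) '' s)) ≤ I • ⊤ := by
  refine (pushIdeal_span_le_biSup _).trans (iSup₂_le ?_)
  rintro _ ⟨y, hy, rfl⟩ _ ⟨z, rfl⟩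
  have : pushMul p e (y ^ p ^ e) z = y • z := rfl
  exact this ▸ Submodule.smul_mem_smul (hs hy) trivial

end PushIdeal

section FrobeniusGenerators

variable {R : Type u} [CommRing R] {p : ℕ} [Fact p.Prime] [CharP R p] {e g h : ℕ}
  {I J K : Ideal R}

theorem GeneratedModulo.pushIdeal_of_mul_span_le (hK : GeneratedModulo (pushIdeal p e K) ⊤ g)
    {s : Finset R} (hs : K * Ideal.span (s : Set R) ≤ I) (hJ : J ≤ I ⊔ Ideal.span (s : Set R)) :
    GeneratedModulo (pushIdeal p e I) (pushIdeal p e J) (s.card * g) := by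
  have hy : ∀ y ∈ s, GeneratedModulo (pushIdeal p e I) (LinearMap.range (pushMul p e y)) g := by
    intro y hy
    rw [← Submodule.map_top]
    refine hK.map _ fun z hz => ?_
    obtain ⟨x, rfl⟩ := (push R p e).surjective z
    rw [Submodule.mem_comap, pushMul_push, push_mem_pushIdeal, mul_comm]
    exact hs (Ideal.mul_mem_mul hz (Ideal.subset_span hy))
  refine (GeneratedModulo.biSup s hy).sup_left.mono le_rfl ?_ le_rfl
  calc pushIdeal p e J ≤ pushIdeal p e I ⊔ pushIdeal p e (Ideal.span (s : Set R)) :=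
        (pushIdeal_mono hJ).trans pushIdeal_sup_le
    _ ≤ _ := sup_le_sup_left (pushIdeal_span_le_biSup _) _

theorem GeneratedModulo.pushIdeal_sup_span_pow {y : R}
    (hy : GeneratedModulo (pushIdeal p e (I ⊔ Ideal.span {y})) ⊤ g) (n : ℕ) :
    GeneratedModulo (pushIdeal p e (I ⊔ Ideal.span {y ^ n})) ⊤ (n * g) := by
  induction n with
  | zero =>
    rw [zero_mul, pow_zero, Ideal.span_singleton_one, sup_top_eq, pushIdeal_top]
    exact .of_le le_rfl
  | succ n ih =>
    rw [add_mul]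
    refine ih.trans ?_
    have := hy.pushIdeal_of_mul_span_le (s := {y ^ n}) (J := I ⊔ Ideal.span {y ^ n})
      (I := I ⊔ Ideal.span {y ^ (n + 1)}) ?_ ?_
    · simpa only [Finset.card_singleton] using this
    · rw [Finset.coe_singleton, Ideal.sup_mul, Ideal.span_singleton_mul_span_singleton, ← pow_succ']
      exact sup_le_sup_right Ideal.mul_le_left _
    · rw [Finset.coe_singleton]
      exact sup_le_sup_right le_sup_left _

theorem GeneratedModulo.pushIdeal_sup_span_image_pow (n : ℕ) (s : Finset R) :
    ∀ {I : Ideal R}, GeneratedModulo (pushIdeal p e (I ⊔ Ideal.span (s : Set R))) ⊤ g →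
      GeneratedModulo (pushIdeal p e (I ⊔ Ideal.span ((· ^ n) '' (s : Set R)))) ⊤
        (n ^ s.card * g) := by
  classical
  induction s using Finset.induction_on with
  | empty => intro I h; simpa using h
  | insert a s ha ih =>
    intro I h
    rw [Finset.coe_insert, Ideal.span_insert, ← sup_assoc] at h
    have hs := ih h
    rw [sup_right_comm] at hs
    rw [Finset.coe_insert, Set.image_insert_eq, Ideal.span_insert, Finset.card_insert_of_notMem ha,
      ← sup_assoc, sup_right_comm, pow_succ', mul_assoc]
    exact hs.pushIdeal_sup_span_pow n

theorem GeneratedModulo.pushIdeal_add {a b : ℕ} (hI : GeneratedModulo (pushIdeal p b I) ⊤ h)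
    (hJ : GeneratedModulo (pushIdeal p a J) ⊤ g) (hJI : ∀ x ∈ J, x ^ p ^ b ∈ I) :
    GeneratedModulo (pushIdeal p (a + b) I) ⊤ (h * g) := by
  obtain ⟨s, hs, htop⟩ := hI
  let L (y : FrobPush R p b) : FrobPush R p a →ₗ[R] FrobPush R p (a + b) :=
    pushMul p (a + b) ((push R p b).symm y) ∘ₗ pushFrobenius R p a b
  have hL : ∀ y ∈ s, GeneratedModulo (pushIdeal p (a + b) I) (LinearMap.range (L y)) g := by
    intro y _
    rw [← Submodule.map_top]
    exact hJ.map _ fun z hz => I.mul_mem_left _ (hJI _ hz)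
  refine (GeneratedModulo.biSup s hL).sup_left.mono le_rfl ?_ (Nat.mul_le_mul_right g hs)
  intro x _
  obtain ⟨z, hz, w, hw, hzw⟩ := Submodule.mem_sup.1 (htop (trivial : push R p b
    ((push R p (a + b)).symm x) ∈ ⊤))
  obtain ⟨c, hc⟩ := Submodule.mem_span_finset.1 hw
  have hx : x = push R p (a + b) ((push R p b).symm z) + ∑ y ∈ s, L y (push R p a (c y)) := by
    have hLy (y : FrobPush R p b) :
        L y (push R p a (c y)) = push R p (a + b) ((push R p b).symm (c y • y)) :=
      congrArg (push R p (a + b)) (mul_comm _ _)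
    simp only [hLy, ← map_sum, hc.2, ← map_add, hzw, AddEquiv.symm_apply_apply,
      AddEquiv.apply_symm_apply]
  rw [hx]
  exact Submodule.add_mem_sup hz (sum_mem fun y hy => Submodule.mem_iSup_of_mem y
    (Submodule.mem_iSup_of_mem hy ⟨_, rfl⟩))

end FrobeniusGenerators

section ResidueDegree

open IsLocalRing

variable (R : Type u) [CommRing R] [IsLocalRing R] (p : ℕ) [Fact p.Prime] [CharP R p]

/-- The degree `[k : k^p]`, where `k` is the residue field of `R`. -/
noncomputable def residueDegree : ℕ :=
  haveI := charP_residueField R p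
  Module.finrank (frobenius (ResidueField R) p).fieldRange (ResidueField R)

variable {R p}

theorem finite_residueField_over_frobenius_fieldRange (hF : IsFFinite R p) :
    haveI := charP_residueField R p
    Module.Finite (frobenius (ResidueField R) p).fieldRange (ResidueField R) := by
  have := charP_residueField R p
  have hfrob : (iterateFrobenius R p 1).Finite := hF
  have hcomp : ((frobenius (ResidueField R) p).comp (residue R)).Finite := by
    have : (frobenius (ResidueField R) p).comp (residue R) =
        (residue R).comp (iterateFrobenius R p 1) := by
      ext x
      simp [iterateFrobenius_one, frobenius_def]
    rw [this]
    exact (RingHom.Finite.of_surjective _ residue_surjective).comp hfrob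
  have hrange : ((frobenius (ResidueField R) p).fieldRange.subtype.comp
      (frobenius (ResidueField R) p).rangeRestrictField).Finite := hcomp.of_comp_finite
  exact RingHom.finite_algebraMap.1 hrange.of_comp_finite

theorem residueDegree_pos (hF : IsFFinite R p) : 0 < residueDegree R p := by
  have := charP_residueField R p
  have := finite_residueField_over_frobenius_fieldRange hF
  exact Module.finrank_pos

theorem generatedModulo_pushIdeal_one_maximalIdeal (hF : IsFFinite R p) :
    GeneratedModulo (pushIdeal p 1 (maximalIdeal R)) ⊤ (residueDegree R p) := by
  classical
  have := charP_residueField R p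
  have := finite_residueField_over_frobenius_fieldRange hF
  let b := Module.finBasis (frobenius (ResidueField R) p).fieldRange (ResidueField R)
  choose u hu using fun i => residue_surjective (b i)
  refine ⟨Finset.univ.image fun i => push R p 1 (u i),
    Finset.card_image_le.trans (by simp [residueDegree]), fun z _ => ?_⟩
  obtain ⟨x, rfl⟩ := (push R p 1).surjective z
  have hroot : ∀ i, ∃ r : R, residue R r ^ p = b.repr (residue R x) i := by
    intro i
    obtain ⟨c, hc⟩ := (b.repr (residue R x) i).2
    obtain ⟨r, rfl⟩ := residue_surjective c
    exact ⟨r, hc⟩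
  choose r hr using hroot
  have hx : x - ∑ i, r i ^ p ^ 1 * u i ∈ maximalIdeal R := by
    rw [← residue_eq_zero_iff, map_sub, sub_eq_zero, map_sum]
    conv_lhs => rw [← b.sum_repr (residue R x)]
    refine Finset.sum_congr rfl fun i _ => ?_
    rw [map_mul, hu, map_pow, pow_one, hr, Subfield.smul_def, smul_eq_mul]
  refine Submodule.mem_sup.2 ⟨_, push_mem_pushIdeal.2 hx, ∑ i, r i • push R p 1 (u i), ?_, ?_⟩
  · exact sum_mem fun i _ => Submodule.smul_mem _ _
      (Submodule.subset_span (Finset.mem_image_of_mem _ (Finset.mem_univ i)))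
  · simp only [smul_push, ← map_sum, ← map_add, sub_add_cancel]

theorem generatedModulo_pushIdeal_maximalIdeal (hF : IsFFinite R p) (e : ℕ) :
    GeneratedModulo (pushIdeal p e (maximalIdeal R)) ⊤ (residueDegree R p ^ e) := by
  induction e with
  | zero =>
    refine ⟨{push R p 0 1}, by simp, fun z _ => Submodule.mem_sup_right ?_⟩
    obtain ⟨x, rfl⟩ := (push R p 0).surjective z
    rw [Finset.coe_singleton, Submodule.mem_span_singleton]
    exact ⟨x, by rw [smul_push, pow_zero, pow_one, mul_one]⟩
  | succ e ih =>
    rw [pow_succ']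
    exact (generatedModulo_pushIdeal_one_maximalIdeal hF).pushIdeal_add ih
      fun x hx => Ideal.pow_mem_of_mem _ hx _ (pow_pos (Fact.out : p.Prime).pos 1)

theorem exists_generatedModulo_pushIdeal_maximalIdeal_pow [IsNoetherianRing R]
    (hF : IsFFinite R p) (N : ℕ) :
    ∃ l : ℕ, ∀ e, GeneratedModulo (pushIdeal p e (maximalIdeal R ^ N)) ⊤
      (l * residueDegree R p ^ e) := by
  induction N with
  | zero => exact ⟨0, fun e => by simpa [pushIdeal_top] using GeneratedModulo.of_le le_rfl⟩
  | succ N ih =>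
    obtain ⟨l, hl⟩ := ih
    obtain ⟨s, hs⟩ := IsNoetherian.noetherian (maximalIdeal R ^ N)
    change Ideal.span (s : Set R) = _ at hs
    refine ⟨l + s.card, fun e => ?_⟩
    rw [add_mul]
    refine (hl e).trans
      ((generatedModulo_pushIdeal_maximalIdeal hF e).pushIdeal_of_mul_span_le (s := s) ?_ ?_)
    · rw [hs, pow_succ']
    · rw [hs]
      exact le_sup_right

theorem exists_generatedModulo_pushIdeal_of_pow_le [IsNoetherianRing R] (hF : IsFFinite R p)
    {I : Ideal R} {s : Finset R} (hs : (s : Set R) ⊆ maximalIdeal R) {N : ℕ}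
    (hN : maximalIdeal R ^ N ≤ I ⊔ Ideal.span (s : Set R)) :
    ∃ l : ℕ, ∀ e, GeneratedModulo (pushIdeal p e I) ⊤
      ((p ^ e) ^ s.card * (l * residueDegree R p ^ e)) := by
  obtain ⟨l, hl⟩ := exists_generatedModulo_pushIdeal_maximalIdeal_pow hF N
  refine ⟨l, fun e => ?_⟩
  have := finite_frobPush hF e
  have hpow :=
    ((hl e).mono (pushIdeal_mono hN) le_rfl le_rfl).pushIdeal_sup_span_image_pow (p ^ e) s
  refine (hpow.mono ?_ le_rfl le_rfl).nakayama
  exact pushIdeal_sup_le.trans (sup_le_sup_left (pushIdeal_span_pow_le hs) _)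

end ResidueDegree

section Dimension

open IsLocalRing

theorem exists_ringKrullDim_eq (R : Type*) [CommRing R] [IsLocalRing R] [IsNoetherianRing R] :
    ∃ d : ℕ, ringKrullDim R = d := by
  obtain ⟨d, hd⟩ := WithBot.ne_bot_iff_exists.1 (ringKrullDim_ne_bot (R := R))
  have htop : d ≠ ⊤ := by
    rintro rfl
    exact ringKrullDim_ne_top hd.symm
  obtain ⟨d, rfl⟩ := ENat.ne_top_iff_exists.1 htop
  exact ⟨d, hd.symm⟩

theorem exists_maximalIdeal_pow_le_span (R : Type*) [CommRing R] [IsLocalRing R]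
    [IsNoetherianRing R] :
    ∃ (s : Finset R) (n : ℕ), (s.card : WithBot ℕ∞) = ringKrullDim R ∧
      (s : Set R) ⊆ maximalIdeal R ∧ maximalIdeal R ^ n ≤ Ideal.span (s : Set R) := by
  obtain ⟨s, hs, hcard⟩ := Ideal.exists_finset_card_eq_height_of_isNoetherianRing (maximalIdeal R)
  have hrad : maximalIdeal R ≤ (Ideal.span (s : Set R)).radical := by
    rw [Ideal.radical_eq_sInf]
    exact le_sInf fun J hJ => hs.2 ⟨hJ.2, hJ.1⟩ (le_maximalIdeal hJ.2.ne_top)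
  obtain ⟨n, hn⟩ := Ideal.exists_pow_le_of_le_radical_of_fg hrad (IsNoetherian.noetherian _)
  refine ⟨s, n, ?_, Ideal.span_le.1 hs.1.2, hn⟩
  rw [← maximalIdeal_height_eq_ringKrullDim, ← hcard]
  rfl

variable {R : Type u} [CommRing R] [IsLocalRing R] [IsNoetherianRing R]

theorem exists_maximalIdeal_pow_le_sup_span {I : Ideal R} (hI : I ≠ ⊤) :
    ∃ (s : Finset R) (n : ℕ), (s.card : WithBot ℕ∞) = ringKrullDim (R ⧸ I) ∧
      (s : Set R) ⊆ maximalIdeal R ∧ maximalIdeal R ^ n ≤ I ⊔ Ideal.span (s : Set R) := by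
  classical
  have : Nontrivial (R ⧸ I) := Ideal.Quotient.nontrivial_iff.2 hI
  have : IsLocalRing (R ⧸ I) := .of_surjective' (Ideal.Quotient.mk I) Ideal.Quotient.mk_surjective
  have : IsLocalHom (Ideal.Quotient.mk I) := .of_surjective _ Ideal.Quotient.mk_surjective
  obtain ⟨t, n, hcard, ht, hn⟩ := exists_maximalIdeal_pow_le_span (R ⧸ I)
  have hsurj : Set.SurjOn (Ideal.Quotient.mk I) (maximalIdeal R) t := by
    intro y hy
    obtain ⟨x, rfl⟩ := Ideal.Quotient.mk_surjective y
    refine ⟨x, ?_, rfl⟩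
    rw [← maximalIdeal_comap (Ideal.Quotient.mk I)]
    exact ht hy
  obtain ⟨s, hs, hinj, rfl⟩ := Finset.exists_subset_injOn_image_eq_of_surjOn _ t hsurj
  refine ⟨s, n, ?_, hs, ?_⟩
  · rw [← hcard, Finset.card_image_of_injOn hinj]
  · rw [Finset.coe_image, ← Ideal.map_span] at hn
    rw [← Ideal.comap_map_quotientMk, ← Ideal.map_le_iff_le_comap, Ideal.map_pow]
    refine (Ideal.pow_right_mono (Ideal.map_le_iff_le_comap.2 ?_) n).trans hn
    exact (maximalIdeal_comap (Ideal.Quotient.mk I)).ge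

variable {p : ℕ} [Fact p.Prime] [CharP R p]

theorem exists_generatedModulo_pushIdeal_of_ringKrullDim_le (hF : IsFFinite R p) {I : Ideal R}
    {δ : ℕ} (hδ : ringKrullDim (R ⧸ I) ≤ δ) :
    ∃ C : ℕ, ∀ e, GeneratedModulo (pushIdeal p e I) ⊤ (C * (p ^ δ * residueDegree R p) ^ e) := by
  by_cases hI : I = ⊤
  · exact ⟨0, fun e => (GeneratedModulo.of_le (pushIdeal_mono hI.ge)).mono le_rfl le_rfl
      (Nat.zero_le _)⟩
  obtain ⟨s, n, hcard, hs, hn⟩ := exists_maximalIdeal_pow_le_sup_span hI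
  have hsδ : s.card ≤ δ := by exact_mod_cast hcard.trans_le hδ
  obtain ⟨l, hl⟩ := exists_generatedModulo_pushIdeal_of_pow_le hF hs hn
  refine ⟨l, fun e => (hl e).mono le_rfl le_rfl ?_⟩
  calc (p ^ e) ^ s.card * (l * residueDegree R p ^ e)
      ≤ (p ^ e) ^ δ * (l * residueDegree R p ^ e) :=
        Nat.mul_le_mul_right _ (Nat.pow_le_pow_right (pow_pos (Fact.out : p.Prime).pos e) hsδ)
    _ = l * (p ^ δ * residueDegree R p) ^ e := by ring

theorem exists_generatedModulo_pushIdeal_bot (hF : IsFFinite R p) {d : ℕ}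
    (hd : ringKrullDim R = d) :
    ∃ C : ℕ, ∀ e, GeneratedModulo (⊥ : Submodule R (FrobPush R p e)) ⊤
      (C * (p ^ d * residueDegree R p) ^ e) :=
  exists_generatedModulo_pushIdeal_of_ringKrullDim_le hF (I := ⊥)
    ((ringKrullDim_quotient_le ⊥).trans hd.le)

theorem exists_generatedModulo_pushIdeal_span_singleton (hF : IsFFinite R p) {d : ℕ}
    (hd : ringKrullDim R = d) {c : R} (hc : c ∈ nonZeroDivisors R) :
    ∃ C : ℕ, ∀ e, ∃ g, GeneratedModulo (pushIdeal p e (Ideal.span {c})) ⊤ g ∧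
      g * p ^ e ≤ C * (p ^ d * residueDegree R p) ^ e := by
  by_cases hu : IsUnit c
  · have htop : Ideal.span {c} = ⊤ := Ideal.span_singleton_eq_top.2 hu
    exact ⟨0, fun e => ⟨0, .of_le (pushIdeal_mono htop.ge), by simp⟩⟩
  have : Nontrivial (R ⧸ Ideal.span {c}) :=
    Ideal.Quotient.nontrivial_iff.2 (by rwa [Ne, Ideal.span_singleton_eq_top])
  have : IsLocalRing (R ⧸ Ideal.span {c}) :=
    .of_surjective' (Ideal.Quotient.mk _) Ideal.Quotient.mk_surjective
  obtain ⟨δ, hδ⟩ := exists_ringKrullDim_eq (R ⧸ Ideal.span {c})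
  have hδd : δ + 1 ≤ d := by
    have := ringKrullDim_quotient_succ_le_of_nonZeroDivisor hc
    rw [hδ, hd] at this
    exact_mod_cast this
  obtain ⟨C, hC⟩ := exists_generatedModulo_pushIdeal_of_ringKrullDim_le hF hδ.le
  refine ⟨C, fun e => ⟨_, hC e, ?_⟩⟩
  calc C * (p ^ δ * residueDegree R p) ^ e * p ^ e
      = C * (p ^ (δ + 1) * residueDegree R p) ^ e := by ring
    _ ≤ C * (p ^ d * residueDegree R p) ^ e := by
      gcongr
      exact (Fact.out : p.Prime).one_le

end Dimension

section Summands

variable {R N : Type u} [CommRing R] [AddCommGroup N] [Module R N] {n : ℕ}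

theorem exists_summandProj_eq {M : Fin n → Submodule R N} (hM : DirectSum.IsInternal M)
    (v : ∀ j, M j) : ∃ x, ∀ j, summandProj M hM j x = v j := by
  refine ⟨LinearEquiv.ofBijective (DirectSum.coeLinearMap M) hM
    ((DirectSum.linearEquivFunOnFintype R (Fin n) fun j => M j).symm v), fun j => ?_⟩
  rw [summandProj, LinearMap.comp_apply, LinearEquiv.coe_coe, LinearEquiv.symm_apply_apply]
  rfl

theorem sum_summandProj {M : Fin n → Submodule R N} (hM : DirectSum.IsInternal M) (x : N) :
    ∑ j, (summandProj M hM j x : N) = x := by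
  classical
  obtain ⟨w, rfl⟩ := (LinearEquiv.ofBijective (DirectSum.coeLinearMap M) hM).surjective x
  have hw (j : Fin n) :
      summandProj M hM j (LinearEquiv.ofBijective (DirectSum.coeLinearMap M) hM w) = w j := by
    rw [summandProj, LinearMap.comp_apply, LinearEquiv.coe_coe, LinearEquiv.symm_apply_apply]
    rfl
  calc ∑ j, (summandProj M hM j _ : N) = ∑ j, (w j : N) := by simp_rw [hw]
    _ = w.sum fun _ x => (x : N) := (DFinsupp.sum_eq_sum_fintype w fun _ => rfl).symm
    _ = DirectSum.coeLinearMap M w := (DirectSum.coeLinearMap_eq_dfinsuppSum M w).symm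

theorem apply_summandProj {M : Fin n → Submodule R N} (hM : DirectSum.IsInternal M) {j : Fin n}
    {φ : N →ₗ[R] R} (hφ : ∀ i, i ≠ j → ∀ x ∈ M i, φ x = 0) (x : N) :
    φ (summandProj M hM j x) = φ x := by
  conv_rhs => rw [← sum_summandProj hM x, map_sum]
  exact (Finset.sum_eq_single_of_mem j (Finset.mem_univ j)
    fun i _ hi => hφ i hi _ (Subtype.prop _)).symm

theorem isInternal_of_projections {ι : Type*} [Fintype ι] [DecidableEq ι] {M : ι → Submodule R N}
    (π : ι → N →ₗ[R] N) (hmem : ∀ i x, π i x ∈ M i) (hsum : ∀ x, ∑ i, π i x = x)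
    (hne : ∀ i j, i ≠ j → ∀ x ∈ M i, π j x = 0) : DirectSum.IsInternal M := by
  have hself (i : ι) (x : N) (hx : x ∈ M i) : π i x = x := by
    conv_rhs => rw [← hsum x]
    exact (Finset.sum_eq_single_of_mem i (Finset.mem_univ i)
      fun j _ hj => hne i j hj.symm x hx).symm
  refine DirectSum.isInternal_submodule_of_iSupIndep_of_iSup_eq_top ?_ ?_
  · rw [iSupIndep_iff_finsetSum_eq_zero_imp_eq_zero]
    intro s v hv hv0 i hi
    have h := congrArg (π i) hv0
    rwa [map_sum, map_zero, Finset.sum_eq_single_of_mem i hi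
      fun j hj hji => hne j i hji _ (hv j hj), hself i _ (hv i hi)] at h
  · exact eq_top_iff.2 fun x _ => hsum x ▸
      sum_mem fun i _ => Submodule.mem_iSup_of_mem i (hmem i x)

theorem isInternal_cons_ker_span {b : ℕ} {φ : Fin b → N →ₗ[R] R} {y : Fin b → N}
    (hy : ∀ i j, φ i (y j) = (1 : Matrix (Fin b) (Fin b) R) i j) :
    DirectSum.IsInternal (Fin.cons (LinearMap.ker (LinearMap.pi φ)) fun j => R ∙ y j :
      Fin (b + 1) → Submodule R N) := by
  let π : Fin (b + 1) → N →ₗ[R] N :=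
    Fin.cons (LinearMap.id - ∑ j, (φ j).smulRight (y j)) fun j => (φ j).smulRight (y j)
  refine isInternal_of_projections π ?_ ?_ ?_
  · refine Fin.cases (fun x => LinearMap.mem_ker.2 (funext fun i => ?_)) fun j x =>
      Submodule.smul_mem _ _ (Submodule.mem_span_singleton_self _)
    simp [π, hy, Matrix.one_apply]
  · intro x
    simp [π, Fin.sum_univ_succ]
  · refine Fin.cases (fun j h0j x hx => ?_) fun i j hij x hx => ?_
    · obtain ⟨j, rfl⟩ := Fin.exists_succ_eq.2 h0j.symm
      have : φ j x = 0 := congrFun (LinearMap.mem_ker.1 hx) j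
      simp [π, this]
    · obtain ⟨r, rfl⟩ := Submodule.mem_span_singleton.1 hx
      cases j using Fin.cases with
      | zero => simp [π, hy, Matrix.one_apply]
      | succ j =>
        have : j ≠ i := by rintro rfl; exact hij rfl
        simp [π, hy, this]

end Summands

section SplittingNumbers

variable {R : Type u} [CommRing R] {p : ℕ} [Fact p.Prime] [CharP R p] {e : ℕ}

theorem exists_pi_surjective_of_mem_summandCounts {D : CartierSubalgebra R p} {a : ℕ}
    (ha : a ∈ summandCounts D e) : ∃ φ : Fin a → CartierMap R p e,
      (∀ i, φ i ∈ D.part e) ∧ Function.Surjective (LinearMap.pi φ) := by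
  obtain ⟨n, M, hM, rfl⟩ := ha
  set S := {j | IsDSummand D e M hM j}
  choose f hf using fun j : S => j.2
  let σ : Fin S.ncard ≃ S := (Finite.equivFin S).symm
  refine ⟨fun i => (f (σ i)).toLinearMap ∘ₗ summandProj M hM (σ i), fun i => hf _, fun v => ?_⟩
  obtain ⟨w, hw⟩ := Subtype.surjective_restrict (β := fun j => M j) (IsDSummand D e M hM)
    fun j => (f j).symm (v (σ.symm j))
  obtain ⟨x, hx⟩ := exists_summandProj_eq hM w
  refine ⟨x, funext fun i => ?_⟩
  have hwi : w (σ i) = (f (σ i)).symm (v i) :=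
    (congrFun hw (σ i)).trans (by rw [σ.symm_apply_apply])
  change f (σ i) (summandProj M hM (σ i) x) = v i
  rw [hx, hwi, LinearEquiv.apply_symm_apply]

theorem exists_pi_surjective [Nontrivial R] (hF : IsFFinite R p) (D : CartierSubalgebra R p)
    (e : ℕ) : ∃ φ : Fin (splittingNumber D e) → CartierMap R p e,
      (∀ i, φ i ∈ D.part e) ∧ Function.Surjective (LinearMap.pi φ) :=
  exists_pi_surjective_of_mem_summandCounts (isGreatest_splittingNumber hF D e).1

theorem isDSummand_span_singleton {D : CartierSubalgebra R p} {n : ℕ}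
    {M : Fin n → Submodule R (FrobPush R p e)} (hM : DirectSum.IsInternal M) {j : Fin n}
    {φ : CartierMap R p e} (hφ : φ ∈ D.part e) (hne : ∀ i, i ≠ j → ∀ x ∈ M i, φ x = 0)
    {y : FrobPush R p e} (hMj : M j = R ∙ y) (hy : φ y = 1) : IsDSummand D e M hM j := by
  have hbij : Function.Bijective (φ ∘ₗ (M j).subtype) := by
    constructor
    · refine (injective_iff_map_eq_zero _).2 fun ⟨z, hz⟩ h => ?_
      obtain ⟨r, rfl⟩ := Submodule.mem_span_singleton.1 (hMj ▸ hz)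
      have hr : r = 0 := by simpa [hy] using h
      simp [hr]
    · exact fun r => ⟨⟨r • y, hMj ▸ Submodule.smul_mem _ _ (Submodule.mem_span_singleton_self _)⟩,
        by simp [hy]⟩
  refine ⟨LinearEquiv.ofBijective _ hbij, ?_⟩
  convert hφ
  exact LinearMap.ext fun z => apply_summandProj hM hne z

theorem le_splittingNumber [Nontrivial R] (hF : IsFFinite R p) {D : CartierSubalgebra R p} {b : ℕ}
    {φ : Fin b → CartierMap R p e} (hφ : ∀ i, φ i ∈ D.part e)
    (hs : Function.Surjective (LinearMap.pi φ)) : b ≤ splittingNumber D e := by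
  choose y hy using fun j => hs ((1 : Matrix (Fin b) (Fin b) R).col j)
  replace hy : ∀ i j, φ i (y j) = (1 : Matrix (Fin b) (Fin b) R) i j := fun i j => congrFun (hy j) i
  have hM := isInternal_cons_ker_span hy
  have hD (j : Fin b) : IsDSummand D e _ hM j.succ := by
    refine isDSummand_span_singleton hM (hφ j) (Fin.cases (fun _ x hx => ?_) fun i hij x hx => ?_)
      rfl (by rw [hy, Matrix.one_apply_eq])
    · exact congrFun (LinearMap.mem_ker.1 hx) j
    · obtain ⟨r, rfl⟩ := Submodule.mem_span_singleton.1 hx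
      have : j ≠ i := by rintro rfl; exact hij rfl
      simp [hy, this]
  calc b = (Set.range (Fin.succ : Fin b → Fin (b + 1))).ncard := by
        rw [← Nat.card_coe_set_eq, Nat.card_range_of_injective (Fin.succ_injective b), Nat.card_fin]
    _ ≤ {j | IsDSummand D e _ hM j}.ncard := Set.ncard_le_ncard (Set.range_subset_iff.2 hD)
    _ ≤ splittingNumber D e := (isGreatest_splittingNumber hF D e).2 ⟨_, _, hM, rfl⟩

end SplittingNumbers

section SplittingIdeals

open IsLocalRing

theorem surjective_pi_cons {R N : Type*} [CommRing R] [AddCommGroup N] [Module R N] {b : ℕ}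
    {φ : Fin b → N →ₗ[R] R} (hφ : Function.Surjective (LinearMap.pi φ)) {ψ : N →ₗ[R] R} {z : N}
    (hz : z ∈ LinearMap.ker (LinearMap.pi φ)) (hψ : IsUnit (ψ z)) :
    Function.Surjective (LinearMap.pi (Fin.cons ψ φ : Fin (b + 1) → N →ₗ[R] R)) := by
  intro v
  obtain ⟨x, hx⟩ := hφ (Fin.tail v)
  obtain ⟨r, hr⟩ := (hψ.dvd : ψ z ∣ v 0 - ψ x)
  refine ⟨x + r • z, funext (Fin.cases ?_ fun i => ?_)⟩
  · simp [mul_comm r, ← hr]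
  · have hzi : φ i z = 0 := congrFun (LinearMap.mem_ker.1 hz) i
    have hxi : φ i x = v i.succ := congrFun hx i
    simp [hzi, hxi]

variable {R : Type u} [CommRing R] {p : ℕ} [Fact p.Prime] [CharP R p]

/-- Multiplication by `c`, as an element of the degree `0` part `Hom_R(R, R)` of the total Cartier
algebra. -/
def CartierMap.scalar (p : ℕ) [Fact p.Prime] [CharP R p] (c : R) : CartierMap R p 0 where
  toFun x := c * (push R p 0).symm x
  map_add' x y := by simp only [map_add, mul_add]
  map_smul' r x := by
    obtain ⟨x, rfl⟩ := (push R p 0).surjective x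
    simp only [smul_push, AddEquiv.symm_apply_apply, pow_zero, pow_one, RingHom.id_apply,
      smul_eq_mul, mul_left_comm]

theorem CartierSubalgebra.scalar_mem (D : CartierSubalgebra R p) (c : R) :
    CartierMap.scalar p c ∈ D.part 0 :=
  D.zero_eq_top ▸ trivial

theorem CartierSubalgebra.mulPush_mem (D : CartierSubalgebra R p) {e : ℕ} {φ : CartierMap R p e}
    (hφ : φ ∈ D.part e) (c : R) : φ.mulPush c ∈ D.part e :=
  D.mul_mem hφ (D.scalar_mem c)

/-- The pushforward `F^a_* ψ : F^{a+b}_* R → F^a_* R` of a map `ψ : F^b_* R → R`, so that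
`φ · ψ = φ ∘ F^a_* ψ`. -/
noncomputable def CartierMap.pushforward {b : ℕ} (ψ : CartierMap R p b) (a : ℕ) :
    FrobPush R p (a + b) →ₗ[R] FrobPush R p a where
  toFun x := push R p a (ψ (push R p b ((push R p (a + b)).symm x)))
  map_add' x y := by simp only [map_add]
  map_smul' r x := by
    obtain ⟨x, rfl⟩ := (push R p (a + b)).surjective x
    rw [smul_push, AddEquiv.symm_apply_apply, AddEquiv.symm_apply_apply, pow_add, pow_mul,
      ← smul_push, map_smul, smul_eq_mul, ← smul_push, RingHom.id_apply]

variable [IsLocalRing R] {D E : CartierSubalgebra R p} {e g : ℕ}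

/-- The `e`-th splitting ideal `I_e^D`: the elements `x` of `R` such that `F^e_* x` is mapped into
the maximal ideal by all of `D_e`. -/
def splittingIdeal (D : CartierSubalgebra R p) (e : ℕ) : Ideal R where
  carrier := {x | ∀ φ ∈ D.part e, φ (push R p e x) ∈ maximalIdeal R}
  add_mem' hx hy φ hφ := by
    rw [map_add, map_add]
    exact add_mem (hx φ hφ) (hy φ hφ)
  zero_mem' φ _ := by
    rw [map_zero, map_zero]
    exact zero_mem _
  smul_mem' c _ hx φ hφ := hx _ (D.mulPush_mem hφ c)

theorem ker_pi_le_pushIdeal_splittingIdeal (hF : IsFFinite R p)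
    {φ : Fin (splittingNumber D e) → CartierMap R p e} (hφ : ∀ i, φ i ∈ D.part e)
    (hs : Function.Surjective (LinearMap.pi φ)) :
    LinearMap.ker (LinearMap.pi φ) ≤ pushIdeal p e (splittingIdeal D e) := by
  intro z hz ψ hψ
  by_contra hunit
  exact absurd (le_splittingNumber hF (Fin.cases hψ hφ)
    (surjective_pi_cons hs hz (notMem_maximalIdeal.1 hunit))) (Nat.not_succ_le_self _)

theorem generatedModulo_pushIdeal_splittingIdeal (hF : IsFFinite R p) (D : CartierSubalgebra R p)
    (e : ℕ) : GeneratedModulo (pushIdeal p e (splittingIdeal D e)) ⊤ (splittingNumber D e) := by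
  obtain ⟨φ, hφ, hs⟩ := exists_pi_surjective hF D e
  exact (GeneratedModulo.ker hs).mono (ker_pi_le_pushIdeal_splittingIdeal hF hφ hs) le_rfl
    (Fintype.card_fin _).le

theorem splittingNumber_le_of_generatedModulo (hF : IsFFinite R p)
    (hg : GeneratedModulo (pushIdeal p e (splittingIdeal D e)) ⊤ g) : splittingNumber D e ≤ g := by
  obtain ⟨φ, hφ, hs⟩ := exists_pi_surjective hF D e
  simpa only [Fintype.card_fin] using
    hg.card_le_of_surjective (LinearMap.pi φ) hs fun x hx i => hx (φ i) (hφ i)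

theorem splittingNumber_mono (hF : IsFFinite R p) (hED : E ≤ D) (e : ℕ) :
    splittingNumber E e ≤ splittingNumber D e :=
  splittingNumber_le_of_generatedModulo hF <|
    (generatedModulo_pushIdeal_splittingIdeal hF D e).mono
      (pushIdeal_mono fun _ hx φ hφ => hx φ (hED e hφ)) le_rfl le_rfl

theorem semigroup_mono (hF : IsFFinite R p) (hED : E ≤ D) : semigroup E ⊆ semigroup D :=
  fun e he => ((Nat.pos_of_ne_zero he).trans_le (splittingNumber_mono hF hED e)).ne'

theorem splittingNumber_le_add_of_mulPush_mem (hF : IsFFinite R p) {c : R}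
    (hc : ∀ φ ∈ D.part e, φ.mulPush c ∈ E.part e)
    (hg : GeneratedModulo (pushIdeal p e (Ideal.span {c})) ⊤ g) :
    splittingNumber D e ≤ splittingNumber E e + g := by
  have hrange : GeneratedModulo (pushIdeal p e (splittingIdeal D e))
      (LinearMap.range (pushMul p e c)) (splittingNumber E e) := by
    rw [← Submodule.map_top]
    exact (generatedModulo_pushIdeal_splittingIdeal hF E e).map _
      fun x hx φ hφ => hx _ (hc φ hφ)
  have htop : GeneratedModulo (LinearMap.range (pushMul p e c)) ⊤ g :=
    hg.mono (by simpa using pushIdeal_span_le_biSup {c}) le_rfl le_rfl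
  rw [add_comm]
  exact splittingNumber_le_of_generatedModulo hF (htop.trans hrange)

theorem card_mul_splittingNumber_le (hF : IsFFinite R p) {n : ℕ} {ι : Type*} [Fintype ι]
    {ψ : ι → CartierMap R p n} (hψ : ∀ i, ψ i ∈ D.part n) {c : R}
    (hc : ∀ v, c • v ∈ LinearMap.range (LinearMap.pi ψ))
    (hg : GeneratedModulo (pushIdeal p e (Ideal.span {c})) ⊤ g) :
    Fintype.card ι * splittingNumber D e ≤ splittingNumber D (e + n) + Fintype.card ι * g := by
  let L : FrobPush R p (e + n) →ₗ[R] ι → FrobPush R p e :=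
    LinearMap.pi fun i => (ψ i).pushforward e
  have hrange : GeneratedModulo (Submodule.pi Set.univ fun _ => pushIdeal p e (splittingIdeal D e))
      (LinearMap.range L) (splittingNumber D (e + n)) := by
    rw [← Submodule.map_top]
    exact (generatedModulo_pushIdeal_splittingIdeal hF D (e + n)).map L
      fun x hx i _ φ hφ => hx _ (D.mul_mem hφ (hψ i))
  have hcL : (Submodule.pi Set.univ fun _ => pushIdeal p e (Ideal.span {c})) ≤
      LinearMap.range L := by
    intro x hx
    have hspan (i : ι) : (push R p e).symm (x i) ∈ Ideal.span {c} := hx i trivial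
    choose z hz using fun i => Ideal.mem_span_singleton'.1 (hspan i)
    obtain ⟨y, hy⟩ := hc z
    refine ⟨push R p (e + n) ((push R p n).symm y), funext fun i => ?_⟩
    exact congrArg (push R p e) ((congrFun hy i).trans ((mul_comm c (z i)).trans (hz i)))
  have htop : GeneratedModulo (LinearMap.range L) ⊤ (Fintype.card ι * g) :=
    (hg.pi ι).mono hcL (by simp) le_rfl
  obtain ⟨φ, hφ, hs⟩ := exists_pi_surjective hF D e
  have hf : Function.Surjective (LinearMap.pi fun ij : ι × Fin (splittingNumber D e) =>
      φ ij.2 ∘ₗ (LinearMap.proj ij.1 : (ι → FrobPush R p e) →ₗ[R] FrobPush R p e)) := by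
    intro v
    choose x hx using fun i => hs fun j => v (i, j)
    exact ⟨x, funext fun ij => congrFun (hx ij.1) ij.2⟩
  have := (htop.trans hrange).card_le_of_surjective _ hf
    fun x hx ij => hx ij.1 trivial (φ ij.2) (hφ ij.2)
  rwa [Fintype.card_prod, Fintype.card_fin, add_comm] at this

end SplittingIdeals

section GenericRank

theorem finrank_compHom_comp {R S T : Type*} [CommRing R] [CommRing S] [CommRing T] [IsDomain T]
    (f : R →+* S) {g : S →+* T} (hg : Function.Injective g) :
    @Module.finrank R T _ _ (Module.compHom T (g.comp f)) =
      @Module.finrank R S _ _ (Module.compHom S f) *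
        @Module.finrank S T _ _ (Module.compHom T g) := by
  let := f.toAlgebra
  let := g.toAlgebra
  let := (g.comp f).toAlgebra
  have : IsScalarTower R S T := .of_algebraMap_eq fun _ => rfl
  have : FaithfulSMul S T := (faithfulSMul_iff_algebraMap_injective S T).2 hg
  exact (Module.finrank_mul_finrank' T).symm

theorem exists_smul_mem_of_finrank_eq {R M : Type*} [CommRing R] [IsDomain R] [AddCommGroup M]
    [Module R M] [Module.Finite R M] {N : Submodule R M}
    (hN : Module.finrank R N = Module.finrank R M) : ∃ c ∈ nonZeroDivisors R, ∀ z, c • z ∈ N := by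
  have htorsion : Module.IsTorsion R (M ⧸ N) :=
    Module.finrank_eq_zero_iff_isTorsion.1 (by have := N.finrank_quotient_add_finrank; omega)
  obtain ⟨c, hc, hc0⟩ := Submodule.annihilator_top_inter_nonZeroDivisors htorsion
  refine ⟨c, hc0, fun z => ?_⟩
  have := Submodule.mem_annihilator.1 hc (Submodule.Quotient.mk z) trivial
  rwa [← Submodule.Quotient.mk_smul, Submodule.Quotient.mk_eq_zero] at this

theorem eq_zero_of_linearIndependent {R M : Type*} [CommRing R] [IsDomain R] [AddCommGroup M]
    [Module R M] [Module.Finite R M] {ι : Type*} [Fintype ι] {x : ι → M}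
    (hx : LinearIndependent R x) (hι : Fintype.card ι = Module.finrank R M) {f : M →ₗ[R] R}
    (hf : ∀ i, f (x i) = 0) : f = 0 := by
  obtain ⟨c, hc, hspan⟩ :=
    exists_smul_mem_of_finrank_eq ((finrank_span_eq_card hx).trans hι)
  have hker : Submodule.span R (Set.range x) ≤ LinearMap.ker f :=
    Submodule.span_le.2 (Set.range_subset_iff.2 hf)
  refine LinearMap.ext fun z => ?_
  have hz : c * f z = 0 := by
    rw [← smul_eq_mul, ← map_smul]
    exact hker (hspan z)
  exact (mul_eq_zero.1 hz).resolve_left (nonZeroDivisors.ne_zero hc)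

variable {R : Type u} [CommRing R] {p : ℕ} [Fact p.Prime] [CharP R p]

variable (R p) in
/-- The generic rank of `F^e_* R`. -/
noncomputable def frobRank (e : ℕ) : ℕ := Module.finrank R (FrobPush R p e)

theorem splittingNumber_le_frobRank [Nontrivial R] (hF : IsFFinite R p)
    (D : CartierSubalgebra R p) (e : ℕ) : splittingNumber D e ≤ frobRank R p e := by
  have := finite_frobPush hF e
  obtain ⟨φ, -, hs⟩ := exists_pi_surjective hF D e
  calc splittingNumber D e = Module.finrank R (Fin (splittingNumber D e) → R) := by
        rw [Module.finrank_fin_fun]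
    _ ≤ frobRank R p e := LinearMap.finrank_le_finrank_of_surjective hs

variable [IsDomain R]

theorem frobRank_add (a b : ℕ) : frobRank R p (a + b) = frobRank R p a * frobRank R p b := by
  have := finrank_compHom_comp (iterateFrobenius R p a) (iterateFrobenius_inj R p b)
  rw [← iterateFrobenius_add, add_comm] at this
  exact this

theorem frobRank_eq_pow (e : ℕ) : frobRank R p e = frobRank R p 1 ^ e := by
  induction e with
  | zero =>
    let f : FrobPush R p 0 ≃ₗ[R] R := (push R p 0).symm.toLinearEquiv fun r x => by
      obtain ⟨x, rfl⟩ := (push R p 0).surjective x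
      simp only [smul_push, AddEquiv.symm_apply_apply, pow_zero, pow_one, smul_eq_mul]
    rw [pow_zero]
    exact f.finrank_eq.trans (Module.finrank_self R)
  | succ e ih => rw [frobRank_add, ih, pow_succ]

theorem CartierMap.mulPush_ne_zero {e : ℕ} {ψ : CartierMap R p e} (hψ : ψ ≠ 0) {z : R}
    (hz : z ≠ 0) : ψ.mulPush z ≠ 0 := by
  contrapose! hψ
  refine LinearMap.ext fun y => ?_
  obtain ⟨y, rfl⟩ := (push R p e).surjective y
  have hzy : z * ψ (push R p e y) = 0 := by
    rw [← smul_eq_mul, ← map_smul, smul_push, ← mul_pow_sub_one (pow_ne_zero e (NeZero.ne p)),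
      mul_assoc]
    exact LinearMap.congr_fun hψ (push R p e (z ^ (p ^ e - 1) * y))
  exact (mul_eq_zero.1 hzy).resolve_left hz

theorem CartierMap.pi_mulPush_injective (hF : IsFFinite R p) {e : ℕ} {ψ : CartierMap R p e}
    (hψ : ψ ≠ 0) {ι : Type*} [Fintype ι] {x : ι → R}
    (hx : LinearIndependent R fun i => push R p e (x i)) (hι : Fintype.card ι = frobRank R p e) :
    Function.Injective (LinearMap.pi fun i => ψ.mulPush (x i)) := by
  have := finite_frobPush hF e
  refine (injective_iff_map_eq_zero _).2 fun z hz => ?_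
  obtain ⟨z, rfl⟩ := (push R p e).surjective z
  by_contra hz0
  refine mulPush_ne_zero hψ (z := z) (by rintro rfl; exact hz0 (map_zero _))
    (eq_zero_of_linearIndependent hx hι fun i => ?_)
  exact (congrArg (ψ ∘ push R p e) (mul_comm z (x i))).trans (congrFun hz i)

theorem exists_smul_mem_range_pi (hF : IsFFinite R p) {D : CartierSubalgebra R p} {e : ℕ}
    (he : D.part e ≠ ⊥) : ∃ c ∈ nonZeroDivisors R, ∃ ψ : Fin (frobRank R p e) → CartierMap R p e,
      (∀ i, ψ i ∈ D.part e) ∧ ∀ v, c • v ∈ LinearMap.range (LinearMap.pi ψ) := by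
  have := finite_frobPush hF e
  obtain ⟨ψ, hψD, hψ⟩ := (D.part e).bot_or_exists_ne_zero.resolve_left he
  obtain ⟨x, hx⟩ := exists_linearIndependent_of_le_finrank (le_refl (frobRank R p e))
  have hinj := CartierMap.pi_mulPush_injective hF hψ (x := (push R p e).symm ∘ x)
    (by simpa using hx) (Fintype.card_fin _)
  obtain ⟨c, hc, hrange⟩ := exists_smul_mem_of_finrank_eq
    ((LinearMap.finrank_range_of_inj hinj).trans (Module.finrank_fin_fun R).symm)
  exact ⟨c, hc, _, fun i => D.mulPush_mem hψD _, hrange⟩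

end GenericRank

section Limits

theorem exists_uniform_le_add_geometric {x : ℕ → ℝ} {b : ℝ} (hb0 : 0 ≤ b) (hb1 : b < 1)
    {Γ : AddSubmonoid ℕ} (h : ∀ n ∈ Γ, ∃ C, ∀ e, x e ≤ x (e + n) + C * b ^ e) :
    ∃ K, 0 ≤ K ∧ ∀ n ∈ Γ, ∀ e, x e ≤ x (e + n) + K * b ^ e := by
  obtain ⟨T, rfl⟩ := Nat.addSubmonoid_fg Γ
  choose! C hC using fun t (ht : t ∈ T) => h t (AddSubmonoid.subset_closure ht)
  obtain ⟨B, hB⟩ := (T.image C).bddAbove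
  have hb : 0 < 1 - b := sub_pos.2 hb1
  -- `K = max B 0 / (1 - b)` solves `K * b + max B 0 = K`, which makes the induction close up.
  set K := max B 0 / (1 - b)
  have hK : max B 0 = K - K * b := by rw [← mul_one_sub, div_mul_cancel₀ _ hb.ne']
  have hK0 : 0 ≤ K := by positivity
  refine ⟨K, hK0, fun n hn => ?_⟩
  induction hn using AddSubmonoid.closure_induction_left with
  | zero => exact fun e => le_add_of_nonneg_right (by positivity)
  | add_left t ht m _ ih =>
    intro e
    obtain rfl | htpos := t.eq_zero_or_pos
    · simpa only [zero_add] using ih e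
    have hCt : C t ≤ K - K * b :=
      hK ▸ (hB (Finset.mem_coe.2 (Finset.mem_image_of_mem C ht))).trans (le_max_left B 0)
    calc x e ≤ x (e + t) + C t * b ^ e := hC t ht e
      _ ≤ x (e + t + m) + K * b ^ (e + t) + C t * b ^ e := by gcongr; exact ih (e + t)
      _ ≤ x (e + t + m) + K * b ^ (e + 1) + (K - K * b) * b ^ e := by
        gcongr x (e + t + m) + K * ?_ + ?_ * b ^ e
        exact pow_le_pow_of_le_one hb0 hb1.le (Nat.add_le_add_left htpos e)
      _ = x (e + (t + m)) + K * b ^ e := by rw [pow_succ, add_assoc e]; ring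

theorem eventually_exists_add_eq_of_mem {Γ : AddSubmonoid ℕ} {e : ℕ} (he : e ∈ Γ) :
    ∀ᶠ m in atTop ⊓ 𝓟 (Γ : Set ℕ), ∃ n ∈ Γ, e + n = m := by
  obtain ⟨N, hN⟩ := Nat.exists_mem_closure_of_ge (Γ : Set ℕ)
  rw [AddSubmonoid.closure_eq] at hN
  rw [eventually_inf_principal]
  filter_upwards [eventually_ge_atTop (e + N)] with m hm hmΓ
  exact ⟨m - e, hN _ (by omega) (Nat.dvd_sub (Nat.setGcd_dvd_of_mem hmΓ)
    (Nat.setGcd_dvd_of_mem he)), by omega⟩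

theorem exists_tendsto_of_le_add_geometric {x : ℕ → ℝ} {b : ℝ} (hb0 : 0 ≤ b) (hb1 : b < 1)
    (hx : BddAbove (Set.range x)) {Γ : AddSubmonoid ℕ}
    (h : ∀ n ∈ Γ, ∃ C, ∀ e, x e ≤ x (e + n) + C * b ^ e) :
    ∃ s, Tendsto x (atTop ⊓ 𝓟 (Γ : Set ℕ)) (𝓝 s) := by
  obtain ⟨K, hK0, hK⟩ := exists_uniform_le_add_geometric hb0 hb1 h
  set A : Set ℝ := (fun e => x e - K * b ^ e) '' Γ
  have hA : BddAbove A := by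
    obtain ⟨B, hB⟩ := hx
    refine ⟨B, ?_⟩
    rintro _ ⟨e, -, rfl⟩
    exact (sub_le_self _ (by positivity)).trans (hB ⟨e, rfl⟩)
  refine ⟨sSup A, tendsto_order.2 ⟨fun a ha => ?_, fun a ha => ?_⟩⟩
  · obtain ⟨_, ⟨e, he, rfl⟩, hae⟩ := exists_lt_of_lt_csSup (Set.Nonempty.image _ ⟨0, Γ.zero_mem⟩) ha
    filter_upwards [eventually_exists_add_eq_of_mem he] with m ⟨n, hn, hm⟩
    exact hae.trans_le (sub_le_iff_le_add.2 (hm ▸ hK n hn e))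
  · have hlim : Tendsto (fun e => sSup A + K * b ^ e) atTop (𝓝 (sSup A)) := by
      simpa using ((tendsto_pow_atTop_nhds_zero_of_lt_one hb0 hb1).const_mul K).const_add (sSup A)
    rw [eventually_inf_principal]
    filter_upwards [hlim.eventually_lt_const ha] with e he heΓ
    exact (sub_le_iff_le_add.1 (le_csSup hA ⟨e, heΓ, rfl⟩)).trans_lt he

end Limits

section Semigroup

variable {R : Type u} [CommRing R] [Nontrivial R] {p : ℕ} [Fact p.Prime] [CharP R p]
  {D : CartierSubalgebra R p} {e : ℕ}

theorem mem_semigroup_iff (hF : IsFFinite R p) :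
    e ∈ semigroup D ↔ ∃ φ ∈ D.part e, ∃ x : R, φ (push R p e x) = 1 := by
  constructor
  · intro he
    obtain ⟨φ, hφ, hs⟩ := exists_pi_surjective hF D e
    obtain ⟨x, hx⟩ := hs 1
    exact ⟨φ ⟨0, Nat.pos_of_ne_zero he⟩, hφ _, (push R p e).symm x, congrFun hx _⟩
  · rintro ⟨φ, hφ, x, hx⟩
    refine Nat.one_le_iff_ne_zero.1 (le_splittingNumber hF (φ := fun _ : Fin 1 => φ)
      (fun _ => hφ) fun v => ⟨v 0 • push R p e x, funext fun i => ?_⟩)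
    rw [LinearMap.pi_apply, map_smul, hx, smul_eq_mul, mul_one, Subsingleton.elim i 0]

/-- `Γ_D` as a submonoid of the natural numbers. -/
def semigroupAddSubmonoid (hF : IsFFinite R p) (D : CartierSubalgebra R p) : AddSubmonoid ℕ where
  carrier := semigroup D
  zero_mem' := (mem_semigroup_iff hF).2 ⟨CartierMap.scalar p 1, D.scalar_mem 1, 1, mul_one 1⟩
  add_mem' {a b} ha hb := by
    obtain ⟨φ, hφ, x, hx⟩ := (mem_semigroup_iff hF).1 ha
    obtain ⟨ψ, hψ, y, hy⟩ := (mem_semigroup_iff hF).1 hb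
    have hψx : ψ (push R p b (x ^ p ^ b * y)) = x := by
      rw [← smul_push, map_smul, hy, smul_eq_mul, mul_one]
    exact (mem_semigroup_iff hF).2 ⟨φ.mul ψ, D.mul_mem hφ hψ, x ^ p ^ b * y,
      (congrArg (φ ∘ push R p a) hψx).trans hx⟩

theorem part_ne_bot_of_mem_semigroup (hF : IsFFinite R p) (he : e ∈ semigroup D) :
    D.part e ≠ ⊥ := by
  obtain ⟨φ, hφ, x, hx⟩ := (mem_semigroup_iff hF).1 he
  refine ne_bot_of_le_ne_bot ?_ (AddSubgroup.zmultiples_le.2 hφ)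
  intro h
  simp [AddSubgroup.zmultiples_eq_bot.1 h] at hx

theorem isReduced_of_mem_semigroup (hF : IsFFinite R p) (he : e ∈ semigroup D) (hpos : 0 < e) :
    IsReduced R := by
  obtain ⟨φ, -, z, hz⟩ := (mem_semigroup_iff hF).1 he
  refine (isReduced_iff_pow_one_lt (p ^ e)
    (Nat.one_lt_pow hpos.ne' (Fact.out : p.Prime).one_lt)).2 fun x hx => ?_
  calc x = x • φ (push R p e z) := by rw [hz, smul_eq_mul, mul_one]
    _ = 0 := by rw [← map_smul, smul_push, hx, zero_mul, map_zero, map_zero]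

theorem isReduced_of_infinite_semigroup (hF : IsFFinite R p) (h : (semigroup D).Infinite) :
    IsReduced R :=
  let ⟨_, he, hpos⟩ := h.exists_gt 0
  isReduced_of_mem_semigroup hF he hpos

end Semigroup

section MinimalPrimes

variable {R : Type u} [CommRing R]

theorem mem_nonZeroDivisors_of_notMem_minimalPrimes [IsReduced R] {c : R}
    (hc : ∀ P ∈ minimalPrimes R, c ∉ P) : c ∈ nonZeroDivisors R := by
  refine mem_nonZeroDivisors_iff_right.2 fun y hy => ?_
  have hmem : y ∈ sInf (minimalPrimes R) := by
    refine Submodule.mem_sInf.2 fun P hP => ?_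
    exact (hP.1.1.mem_or_mem (hy ▸ P.zero_mem : y * c ∈ P)).resolve_right (hc P hP)
  rwa [minimalPrimes, Ideal.sInf_minimalPrimes, Ideal.isRadical_bot.radical] at hmem

theorem isDomain_of_subsingleton_minimalPrimes [Nontrivial R] [IsReduced R]
    (h : (minimalPrimes R).Subsingleton) : IsDomain R := by
  obtain ⟨P, hP⟩ := Set.nonempty_coe_sort.1
    (Ideal.nonempty_minimalPrimes (bot_ne_top (α := Ideal R)))
  have hbot : P = ⊥ := by
    rw [← sInf_singleton (a := P), ← h.eq_singleton_of_mem hP, minimalPrimes,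
      Ideal.sInf_minimalPrimes, Ideal.isRadical_bot.radical]
  have : (⊥ : Ideal R).IsPrime := hbot ▸ hP.1.1
  exact IsDomain.of_bot_isPrime R

theorem exists_mem_nonZeroDivisors_mem_sup_minimalPrimes [IsNoetherianRing R] [IsReduced R]
    {P Q : Ideal R} (hP : P ∈ minimalPrimes R) (hQ : Q ∈ minimalPrimes R) (hPQ : P ≠ Q) :
    ∃ c ∈ nonZeroDivisors R, c ∈ P ⊔ Q := by
  have hnot : ¬ ((P ⊔ Q : Ideal R) : Set R) ⊆ ⋃ I ∈ minimalPrimes R, (I : Set R) := by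
    rw [Ideal.subset_union_prime_finite (minimalPrimes.finite_of_isNoetherianRing R) P P
      fun I hI _ _ => hI.1.1]
    rintro ⟨I, hI, hle⟩
    have hPI : P = I := le_antisymm (le_sup_left.trans hle) (hI.2 hP.1 (le_sup_left.trans hle))
    have hQI : Q = I := le_antisymm (le_sup_right.trans hle) (hI.2 hQ.1 (le_sup_right.trans hle))
    exact hPQ (hPI.trans hQI.symm)
  obtain ⟨c, hc, hcI⟩ := Set.not_subset.1 hnot
  exact ⟨c, mem_nonZeroDivisors_of_notMem_minimalPrimes fun I hI hmem =>
    hcI (Set.mem_biUnion hI hmem), hc⟩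

variable [IsLocalRing R] {p : ℕ} [Fact p.Prime] [CharP R p]

theorem mem_splittingIdeal_of_notMem_nonZeroDivisors (D : CartierSubalgebra R p) (e : ℕ) {x : R}
    (hx : x ∉ nonZeroDivisors R) : x ∈ splittingIdeal D e := by
  intro φ _
  rw [mem_nonZeroDivisors_iff_right] at hx
  push Not at hx
  obtain ⟨y, hyx, hy⟩ := hx
  have hyφ : y * φ (push R p e x) = 0 := by
    rw [← smul_eq_mul, ← map_smul, smul_push, ← pow_sub_one_mul (pow_ne_zero e (NeZero.ne p)),
      mul_assoc, hyx, mul_zero, map_zero, map_zero]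
  exact (IsLocalRing.mem_maximalIdeal _).2 fun hu => hy (hu.mul_left_eq_zero.1 hyφ)

theorem exists_mem_nonZeroDivisors_forall_mem_splittingIdeal [IsNoetherianRing R] [IsReduced R]
    (hR : ¬ IsDomain R) (D : CartierSubalgebra R p) :
    ∃ c ∈ nonZeroDivisors R, ∀ e, c ∈ splittingIdeal D e := by
  obtain ⟨P, hP, Q, hQ, hPQ⟩ :=
    Set.not_subsingleton_iff.1 (mt isDomain_of_subsingleton_minimalPrimes hR)
  obtain ⟨c, hc, hmem⟩ := exists_mem_nonZeroDivisors_mem_sup_minimalPrimes hP hQ hPQ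
  have hle {I : Ideal R} (hI : I ∈ minimalPrimes R) (e : ℕ) : I ≤ splittingIdeal D e :=
    fun _ hx => mem_splittingIdeal_of_notMem_nonZeroDivisors D e
      (notMem_nonZeroDivisors_of_mem_mem_minimalPrimes hx hI)
  exact ⟨c, hc, fun e => sup_le (hle hP e) (hle hQ e) hmem⟩

end MinimalPrimes

section FSignature

variable {R : Type u} [CommRing R] [IsLocalRing R] {p : ℕ} [Fact p.Prime] [CharP R p]
  {D E : CartierSubalgebra R p} {d e : ℕ}

/-- The quotients `a_e^D / p^{e (d + α(R))}`, whose limit along `Γ_D` is the `F`-signature when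
`d = dim R`. -/
noncomputable def normalizedSplittingNumber (D : CartierSubalgebra R p) (d e : ℕ) : ℝ :=
  splittingNumber D e / (p : ℝ) ^ ((e : ℝ) * (d + alpha R p))

theorem normalizedSplittingNumber_eq (hF : IsFFinite R p) (D : CartierSubalgebra R p) (d e : ℕ) :
    normalizedSplittingNumber D d e =
      splittingNumber D e / ((p ^ d * residueDegree R p : ℕ) : ℝ) ^ e := by
  have hp : 1 < (p : ℝ) := Nat.one_lt_cast.2 (Fact.out : p.Prime).one_lt
  have hp0 : 0 < (p : ℝ) := zero_lt_one.trans hp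
  have hα : (p : ℝ) ^ alpha R p = residueDegree R p :=
    Real.rpow_logb hp0 hp.ne' (Nat.cast_pos.2 (residueDegree_pos hF))
  rw [normalizedSplittingNumber, mul_comm, Real.rpow_mul hp0.le, Real.rpow_natCast,
    Real.rpow_add hp0, hα, Real.rpow_natCast, Nat.cast_mul, Nat.cast_pow]

theorem normalizer_pos (hF : IsFFinite R p) (d : ℕ) : 0 < p ^ d * residueDegree R p :=
  Nat.mul_pos (pow_pos (Fact.out : p.Prime).pos d) (residueDegree_pos hF)

theorem inv_prime_lt_one : (p : ℝ)⁻¹ < 1 :=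
  inv_lt_one_of_one_lt₀ (Nat.one_lt_cast.2 (Fact.out : p.Prime).one_lt)

theorem tendsto_const_mul_inv_prime_pow (C : ℝ) :
    Tendsto (fun e : ℕ => C * (p : ℝ)⁻¹ ^ e) atTop (𝓝 0) := by
  simpa only [mul_zero] using (tendsto_pow_atTop_nhds_zero_of_lt_one (by positivity)
    (inv_prime_lt_one (p := p))).const_mul C

theorem le_of_forall_pow_le_mul_pow {a b C : ℕ} (h : ∀ e, a ^ e ≤ C * b ^ e) : a ≤ b := by
  by_contra! hlt
  obtain rfl | hb := b.eq_zero_or_pos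
  · simpa [hlt.ne'] using h 1
  have hb0 : (0 : ℝ) < b := Nat.cast_pos.2 hb
  have hab : 1 < (a / b : ℝ) := (one_lt_div hb0).2 (Nat.cast_lt.2 hlt)
  obtain ⟨e, he⟩ := ((tendsto_pow_atTop_atTop_of_one_lt hab).eventually_gt_atTop (C : ℝ)).exists
  rw [div_pow, lt_div_iff₀ (by positivity)] at he
  exact he.not_ge (mod_cast h e)

theorem tendsto_normalizedSplittingNumber_of_finite (h : (semigroup E).Finite) (d : ℕ) :
    Tendsto (normalizedSplittingNumber E d) atTop (𝓝 0) := by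
  refine tendsto_const_nhds.congr' ?_
  rw [← Nat.cofinite_eq_atTop]
  filter_upwards [h.compl_mem_cofinite] with e he
  rw [normalizedSplittingNumber, not_not.1 he, Nat.cast_zero, zero_div]

theorem normalizedSplittingNumber_le_pow [IsDomain R] (hF : IsFFinite R p)
    (D : CartierSubalgebra R p) (d e : ℕ) :
    normalizedSplittingNumber D d e ≤
      ((frobRank R p 1 : ℝ) / ((p ^ d * residueDegree R p : ℕ) : ℝ)) ^ e := by
  rw [normalizedSplittingNumber_eq hF, div_pow]
  gcongr
  exact_mod_cast frobRank_eq_pow (R := R) (p := p) e ▸ splittingNumber_le_frobRank hF D e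

variable [IsNoetherianRing R]

theorem exists_generatedModulo_div_le (hF : IsFFinite R p) (hd : ringKrullDim R = d) {c : R}
    (hc : c ∈ nonZeroDivisors R) :
    ∃ C : ℝ, ∀ e, ∃ g, GeneratedModulo (pushIdeal p e (Ideal.span {c})) ⊤ g ∧
      g / ((p ^ d * residueDegree R p : ℕ) : ℝ) ^ e ≤ C * (p : ℝ)⁻¹ ^ e := by
  obtain ⟨C, hC⟩ := exists_generatedModulo_pushIdeal_span_singleton (p := p) hF hd hc
  refine ⟨C, fun e => ?_⟩
  obtain ⟨g, hg, hle⟩ := hC e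
  have hν : 0 < ((p ^ d * residueDegree R p : ℕ) : ℝ) := Nat.cast_pos.2 (normalizer_pos hF d)
  have hp : 0 < (p : ℝ) := Nat.cast_pos.2 (Fact.out : p.Prime).pos
  refine ⟨g, hg, ?_⟩
  rw [inv_pow, ← div_eq_mul_inv, div_le_div_iff₀ (by positivity) (by positivity)]
  exact_mod_cast hle

theorem tendsto_normalizedSplittingNumber_of_not_isDomain [IsReduced R] (hR : ¬ IsDomain R)
    (hF : IsFFinite R p) (hd : ringKrullDim R = d) (D : CartierSubalgebra R p) :
    Tendsto (normalizedSplittingNumber D d) atTop (𝓝 0) := by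
  obtain ⟨c, hc, hcD⟩ := exists_mem_nonZeroDivisors_forall_mem_splittingIdeal hR D
  obtain ⟨C, hC⟩ := exists_generatedModulo_div_le hF hd hc
  refine squeeze_zero (fun e => ?_) (fun e => ?_) (tendsto_const_mul_inv_prime_pow (p := p) C)
  · rw [normalizedSplittingNumber_eq hF]
    positivity
  · obtain ⟨g, hg, hgC⟩ := hC e
    have hle : splittingNumber D e ≤ g := splittingNumber_le_of_generatedModulo hF
      (hg.mono (pushIdeal_mono ((Ideal.span_singleton_le_iff_mem _).2 (hcD e))) le_rfl le_rfl)
    rw [normalizedSplittingNumber_eq hF]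
    exact le_trans (by gcongr) hgC

theorem tendsto_normalizedSplittingNumber_sub (hF : IsFFinite R p) (hd : ringKrullDim R = d)
    (hED : E ≤ D) {c : R} (hc : c ∈ nonZeroDivisors R)
    (hcE : ∀ e : ℕ, 0 < e → ∀ φ ∈ D.part e, φ.mulPush c ∈ E.part e) :
    Tendsto (fun e => normalizedSplittingNumber D d e - normalizedSplittingNumber E d e)
      atTop (𝓝 0) := by
  obtain ⟨C, hC⟩ := exists_generatedModulo_div_le hF hd hc
  simp only [normalizedSplittingNumber_eq hF]
  refine squeeze_zero' (Eventually.of_forall fun e => ?_) ?_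
    (tendsto_const_mul_inv_prime_pow (p := p) C)
  · rw [sub_nonneg]
    gcongr
    exact splittingNumber_mono hF hED e
  · filter_upwards [eventually_gt_atTop 0] with e he
    obtain ⟨g, hg, hgC⟩ := hC e
    refine le_trans ?_ hgC
    rw [sub_le_iff_le_add', ← add_div]
    gcongr
    exact_mod_cast splittingNumber_le_add_of_mulPush_mem hF (hcE e he) hg

theorem frobRank_one_le [IsDomain R] (hF : IsFFinite R p) (hd : ringKrullDim R = d) :
    frobRank R p 1 ≤ p ^ d * residueDegree R p := by
  obtain ⟨C, hC⟩ := exists_generatedModulo_pushIdeal_bot (p := p) hF hd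
  refine le_of_forall_pow_le_mul_pow (C := C) fun e => ?_
  rw [← frobRank_eq_pow]
  exact (hC e).finrank_le

theorem exists_normalizedSplittingNumber_le_add [IsDomain R] (hF : IsFFinite R p)
    (hd : ringKrullDim R = d) (hrank : frobRank R p 1 = p ^ d * residueDegree R p) {n : ℕ}
    (hn : D.part n ≠ ⊥) :
    ∃ C : ℝ, ∀ e, normalizedSplittingNumber D d e ≤
      normalizedSplittingNumber D d (e + n) + C * (p : ℝ)⁻¹ ^ e := by
  obtain ⟨c, hc, ψ, hψ, hψc⟩ := exists_smul_mem_range_pi hF hn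
  obtain ⟨C, hC⟩ := exists_generatedModulo_div_le hF hd hc
  refine ⟨C, fun e => ?_⟩
  obtain ⟨g, hg, hgC⟩ := hC e
  have hstep := card_mul_splittingNumber_le hF hψ hψc hg
  rw [Fintype.card_fin, frobRank_eq_pow, hrank] at hstep
  have hν : 0 < ((p ^ d * residueDegree R p : ℕ) : ℝ) := Nat.cast_pos.2 (normalizer_pos hF d)
  simp only [normalizedSplittingNumber_eq hF]
  set ν := p ^ d * residueDegree R p
  calc (splittingNumber D e : ℝ) / (ν : ℝ) ^ e
      = (ν : ℝ) ^ n * splittingNumber D e / (ν : ℝ) ^ (e + n) := by rw [pow_add]; field_simp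
    _ ≤ (splittingNumber D (e + n) + (ν : ℝ) ^ n * g) / (ν : ℝ) ^ (e + n) := by
      gcongr
      exact_mod_cast hstep
    _ = splittingNumber D (e + n) / (ν : ℝ) ^ (e + n) + g / (ν : ℝ) ^ e := by
      rw [pow_add]; field_simp
    _ ≤ _ := by gcongr

theorem exists_tendsto_normalizedSplittingNumber_of_isDomain [IsDomain R] (hF : IsFFinite R p)
    (hd : ringKrullDim R = d) (D : CartierSubalgebra R p) :
    ∃ s, Tendsto (normalizedSplittingNumber D d) (atTop ⊓ 𝓟 (semigroup D)) (𝓝 s) := by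
  have hν : 0 < ((p ^ d * residueDegree R p : ℕ) : ℝ) := Nat.cast_pos.2 (normalizer_pos hF d)
  have hle := normalizedSplittingNumber_le_pow hF D d
  obtain hlt | heq := (frobRank_one_le hF hd).lt_or_eq
  · refine ⟨0, Tendsto.mono_left (squeeze_zero (fun e => ?_) hle ?_) inf_le_left⟩
    · rw [normalizedSplittingNumber_eq hF]
      positivity
    · exact tendsto_pow_atTop_nhds_zero_of_lt_one (by positivity)
        ((div_lt_one hν).2 (Nat.cast_lt.2 hlt))
  · refine exists_tendsto_of_le_add_geometric (Γ := semigroupAddSubmonoid hF D)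
      (by positivity) (inv_prime_lt_one (p := p)) ⟨1, ?_⟩ fun n hn =>
        exists_normalizedSplittingNumber_le_add hF hd heq (part_ne_bot_of_mem_semigroup hF hn)
    rintro _ ⟨e, rfl⟩
    simpa only [heq, div_self hν.ne', one_pow] using hle e

theorem exists_hasFSignature (hF : IsFFinite R p) (D : CartierSubalgebra R p) :
    ∃ s, HasFSignature D s := by
  obtain ⟨d, hd⟩ := exists_ringKrullDim_eq R
  obtain hfin | hinf := (semigroup D).finite_or_infinite
  · exact ⟨0, d, hd, fun h => absurd hfin h, fun _ => rfl⟩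
  have := isReduced_of_infinite_semigroup hF hinf
  obtain ⟨s, hs⟩ :
      ∃ s, Tendsto (normalizedSplittingNumber D d) (atTop ⊓ 𝓟 (semigroup D)) (𝓝 s) := by
    by_cases hR : IsDomain R
    · exact exists_tendsto_normalizedSplittingNumber_of_isDomain hF hd D
    · exact ⟨0, (tendsto_normalizedSplittingNumber_of_not_isDomain hR hF hd D).mono_left
        inf_le_left⟩
  exact ⟨s, d, hd, fun _ => hs, fun h => absurd h hinf⟩

theorem HasFSignature.of_mulPush_mem {s : ℝ} (hs : HasFSignature D s) (hF : IsFFinite R p)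
    (hED : E ≤ D) {c : R} (hc : ∀ P ∈ minimalPrimes R, c ∉ P)
    (hcE : ∀ e : ℕ, 0 < e → ∀ φ ∈ D.part e, φ.mulPush c ∈ E.part e) : HasFSignature E s := by
  obtain ⟨d, hd, hlim, hzero⟩ := hs
  obtain hfin | hinf := (semigroup D).finite_or_infinite
  · exact ⟨d, hd, fun h => absurd (hfin.subset (semigroup_mono hF hED)) h, fun _ => hzero hfin⟩
  have := isReduced_of_infinite_semigroup hF hinf
  have hsub := tendsto_normalizedSplittingNumber_sub hF hd hED
    (mem_nonZeroDivisors_of_notMem_minimalPrimes hc) hcE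
  have hE : Tendsto (normalizedSplittingNumber E d) (atTop ⊓ 𝓟 (semigroup D)) (𝓝 s) := by
    simpa only [sub_sub_cancel, sub_zero] using
      Tendsto.sub (f := normalizedSplittingNumber D d) (hlim hinf) (hsub.mono_left inf_le_left)
  refine ⟨d, hd, fun _ => hE.mono_left (inf_le_inf_left _ (principal_mono.2
    (semigroup_mono hF hED))), fun hEfin => ?_⟩
  have : (atTop ⊓ 𝓟 (semigroup D)).NeBot :=
    frequently_mem_iff_neBot.1 (Nat.frequently_atTop_iff_infinite.2 hinf)
  exact tendsto_nhds_unique hE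
    ((tendsto_normalizedSplittingNumber_of_finite hEfin d).mono_left inf_le_left)

end FSignature

end FSig

theorem lemma4p14 {R : Type u} [CommRing R] [IsLocalRing R] [IsNoetherianRing R]
    (p : ℕ) [Fact p.Prime] [CharP R p] (hF : FSig.IsFFinite R p)
    (D E : FSig.CartierSubalgebra R p) (hED : E ≤ D)
    (hc : ∃ c : R, (∀ P ∈ minimalPrimes R, c ∉ P) ∧
      ∀ e : ℕ, 0 < e → ∀ φ ∈ D.part e, φ.mulPush c ∈ E.part e) :
    ∃ s : ℝ, FSig.HasFSignature D s ∧ FSig.HasFSignature E s := by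
  obtain ⟨c, hcP, hcE⟩ := hc
  obtain ⟨s, hs⟩ := FSig.exists_hasFSignature hF D
  exact ⟨s, hs, hs.of_mulPush_mem hF hED hcP hcE⟩
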